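/- Let $K$ be a global function field with full constant field $\mathbb{F}_q$. A place $\mathfrak p$ of $K$ is the maximal ideal of a discrete valuation ring of $K$; let $v_{\mathfrak p}$ be its normalized valuation, $K_{\mathfrak p}$ the completion of $K$ at $\mathfrak p$, $U_{\mathfrak p}=U_{\mathfrak p}^{(0)}=\{u\in K_{\mathfrak p}^* : v_{\mathfrak p}(u)=0\}$, and, for $n\ge 1$, $U_{\mathfrak p}^{(n)}=1+\bar{\mathfrak p}^{\,n}$, where $\bar{\mathfrak p}$ is the maximal ideal of the valuation ring of $K_{\mathfrak p}$. Let $\mathcal I$ be the idèle group of $K$ (the restricted product of the groups $K_{\mathfrak p}^*$ with respect to the $U_{\mathfrak p}$, over all places $\mathfrak p$), with $K^*\subseteq\mathcal I$ embedded diagonally, and let $\mathcal C=\mathcal I/K^*$ be the idèle class group. Let $S$ be a non-empty (possibly infinite) set of places of $K$, and let $\mathfrak m=\sum_{\mathfrak p} m_{\mathfrak p}\mathfrak p$ be an $S$-cycle, i.e. an effective divisor of $K$ with support disjoint from $S$. Let $\mathcal O_S$ be the ring of all functions in $K$ with poles only in $S$, and put $$\mathcal I_S^{\mathfrak m}=\Big(\prod_{\mathfrak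 p\in S}K_{\mathfrak p}^*\times\prod_{\mathfrak p\notin S}U_{\mathfrak p}^{(m_{\mathfrak p})}\Big)\cap\mathcal I,\qquad \mathcal C_S^{\mathfrak m}=K^*\mathcal I_S^{\mathfrak m}/K^*.$$ Write $\mathcal I_S^{\mathfrak o}$ for this group when $\mathfrak m=\mathfrak o$ is the zero divisor. Then the sequence of natural homomorphisms $$\mathcal O_S^*\longrightarrow \mathcal I_S^{\mathfrak o}/\mathcal I_S^{\mathfrak m}\longrightarrow \mathcal I/K^*\mathcal I_S^{\mathfrak m}\longrightarrow \mathcal I/K^*\mathcal I_S^{\mathfrak o}\longrightarrow 1$$ (the first induced by the diagonal embedding, the second by the inclusion $\mathcal I_S^{\mathfrak o}\subseteq\mathcal I$, the third the canonical projection) is exact, and the index $(\mathcal C:\mathcal C_S^{\mathfrak m})$ is finite. -/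

import Mathlib

open scoped RestrictedProduct WithZero RatFunc Polynomial
open IsDedekindDomain

/-- A place of the field `K`, given by a discrete valuation ring of `K` (a valuation subring of `K`
that is a discrete valuation ring); it determines and is determined by its maximal ideal. -/
@[ext]
structure Place (K : Type*) [Field K] where
  /-- the discrete valuation ring -/
  ring : ValuationSubring K
  isDVR : IsDiscreteValuationRing ring

namespace Place

variable {K : Type*} [Field K]

instance (p : Place K) : IsDiscreteValuationRing p.ring := p.isDVR

/-- The maximal ideal of the valuation ring of `p`. -/
noncomputable def prime (p : Place K) : HeightOneSpectrum p.ring :=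
  IsDiscreteValuationRing.maximalIdeal p.ring

/-- The normalized valuation of `p`, in multiplicative notation: `p.val x = exp (-v_p x)`. -/
noncomputable def val (p : Place K) : Valuation K ℤᵐ⁰ := p.prime.valuation K

/-- The completion `K_p` of `K` at `p`. It carries the extension `Valued.v` of `p.val`. -/
abbrev Completion (p : Place K) : Type _ := p.prime.adicCompletion K

/-- The embedding of `K` into `K_p`. -/
noncomputable def toCompletion (p : Place K) : K →+* p.Completion := algebraMap K p.Completion

lemma v_toCompletion (p : Place K) (x : K) : Valued.v (p.toCompletion x) = p.val x :=
  HeightOneSpectrum.valuedAdicCompletion_eq_valuation' p.prime x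

/-- The `n`-th one-unit group of `K_p`: all units `u` of the valuation ring of `K_p` that are
congruent to `1` modulo the `n`-th power of its maximal ideal. For `n = 0` these are all units of
the valuation ring, and for `1 ≤ n` this is the set of all `u` with `v_p (u - 1) ≥ n`. -/
noncomputable def oneUnits (p : Place K) (n : ℕ) : Subgroup (p.Completion)ˣ where
  carrier := {u | Valued.v (u : p.Completion) = 1 ∧
    Valued.v ((u : p.Completion) - 1) ≤ WithZero.exp (-(n : ℤ))}
  one_mem' := by simp
  mul_mem' := by
    rintro a b ⟨ha, ha'⟩ ⟨hb, hb'⟩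
    refine ⟨by simp [ha, hb], ?_⟩
    have h : ((a * b : (p.Completion)ˣ) : p.Completion) - 1 = a * (b - 1) + (a - 1) := by
      push_cast; ring
    rw [h]
    exact Valued.v.map_add_le (by simpa [ha] using hb') ha'
  inv_mem' := by
    rintro a ⟨ha, ha'⟩
    refine ⟨by simp [ha], ?_⟩
    have h : ((a⁻¹ : (p.Completion)ˣ) : p.Completion) - 1 =
        ((a⁻¹ : (p.Completion)ˣ) : p.Completion) * -(a - 1) := by
      rw [mul_neg, mul_sub, Units.inv_mul]; ring
    rw [h, map_mul, Valuation.map_neg]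
    simpa [ha] using ha'

lemma mem_oneUnits_zero (p : Place K) (u : (p.Completion)ˣ) :
    u ∈ p.oneUnits 0 ↔ Valued.v (u : p.Completion) = 1 :=
  ⟨fun h => h.1, fun h => ⟨h, by
    simpa using Valued.v.map_sub_le h.le (by simp)⟩⟩

lemma val_le_one_iff (p : Place K) (x : K) : p.val x ≤ 1 ↔ x ∈ p.ring := by
  constructor
  · intro h
    obtain ⟨a, rfl⟩ := IsDiscreteValuationRing.exists_lift_of_le_one (A := p.ring) (K := K) h
    exact a.2
  · intro h
    exact p.prime.valuation_le_one (K := K) (⟨x, h⟩ : p.ring)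

lemma exists_val_lt_one (p : Place K) : ∃ x : K, x ≠ 0 ∧ p.val x < 1 := by
  obtain ⟨x, hx⟩ := p.prime.valuation_exists_uniformizer K
  have hx' : p.val x = WithZero.exp (-1 : ℤ) := hx
  refine ⟨x, ?_, ?_⟩
  · rintro rfl
    rw [map_zero] at hx'
    exact WithZero.exp_ne_zero hx'.symm
  · rw [hx', ← WithZero.exp_zero, WithZero.exp_lt_exp]; norm_num

/-- For finitely many places, there are elements that are units at one of them
and vanish at the others. -/
lemma exists_separating {ι : Type*} [Finite ι] (p : ι → Place K) (hp : Function.Injective p)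
    (i : ι) : ∃ z : K, (p i).val z = 1 ∧ ∀ j ≠ i, (p j).val z < 1 := by
  have hb : (1 : NNReal) < 2 := by norm_num
  let w : ι → AbsoluteValue K ℝ := fun i => (p i).prime.adicAbv (K := K) hb
  have hlt (i : ι) (x : K) : w i x < 1 ↔ (p i).val x < 1 := by
    change ((HeightOneSpectrum.adicAbvDef (p i).prime hb x : NNReal) : ℝ) < 1 ↔ _
    rw [NNReal.coe_lt_one, HeightOneSpectrum.adicAbvDef, WithZeroMulInt.toNNReal_lt_one_iff hb]
    rfl
  have hle (i : ι) (x : K) : w i x ≤ 1 ↔ (p i).val x ≤ 1 := by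
    change ((HeightOneSpectrum.adicAbvDef (p i).prime hb x : NNReal) : ℝ) ≤ 1 ↔ _
    rw [NNReal.coe_le_one, HeightOneSpectrum.adicAbvDef, WithZeroMulInt.toNNReal_le_one_iff hb]
    rfl
  have hnt (i : ι) : (w i).IsNontrivial := by
    obtain ⟨x, hx0, hx⟩ := (p i).exists_val_lt_one
    exact ⟨x, hx0, ((hlt i x).2 hx).ne⟩
  have hne : Pairwise fun i j => ¬ (w i).IsEquiv (w j) := by
    intro i j hij h
    refine hij (hp (Place.ext (ValuationSubring.ext _ _ fun x => ?_)))
    rw [← val_le_one_iff, ← val_le_one_iff, ← hle, ← hle]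
    exact h.le_one_iff
  obtain ⟨a, ha, ha'⟩ := AbsoluteValue.exists_one_lt_lt_one_pi_of_not_isEquiv hnt hne i
  have hai : 1 < (p i).val a := by rw [← not_le, ← hle, not_le]; exact ha
  refine ⟨a / (1 + a), ?_, fun j hj => ?_⟩
  · rw [map_div₀, Valuation.map_add_eq_of_lt_right _ (by rwa [map_one])]
    exact div_self (zero_lt_one.trans hai).ne'
  · have hj' := (hlt j a).1 (ha' j hj)
    rw [map_div₀, Valuation.map_add_eq_of_lt_left _ (by rwa [map_one]), map_one, div_one]
    exact hj'

/-- There are only finitely many places of `K` above a given place of a subfield of finite index. -/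
lemma finite_comap_eq {L : Type*} [Field L] [Algebra L K] [FiniteDimensional L K]
    (B : ValuationSubring L) : {p : Place K | p.ring.comap (algebraMap L K) = B}.Finite := by
  classical
  refine Set.finite_of_encard_le_coe (k := Module.finrank L K) ?_
  by_contra hcon
  rw [not_le] at hcon
  obtain ⟨T, hT, hcard⟩ := Set.exists_subset_encard_eq (Order.add_one_le_of_lt hcon)
  have hTf : T.Finite := Set.finite_of_encard_eq_coe (k := Module.finrank L K + 1) (by simpa using hcard)
  have : Fintype T := hTf.fintype
  have hc : Fintype.card T = Module.finrank L K + 1 := by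
    have := hcard
    rw [Set.encard_eq_coe_toFinset_card, Set.toFinset_card] at this
    exact_mod_cast this
  choose z hz1 hz using exists_separating (fun i : T => (i : Place K)) Subtype.val_injective
  have hli : LinearIndependent L z := by
    rw [Fintype.linearIndependent_iff]
    intro c hsum
    by_contra hne
    push Not at hne
    obtain ⟨i₁, hi₁⟩ := hne
    obtain ⟨i₀, -, hmax⟩ := Finset.exists_max_image Finset.univ (fun i => B.valuation (c i))
      ⟨i₁, Finset.mem_univ _⟩
    have h0 : c i₀ ≠ 0 := by
      intro h
      have := hmax i₁ (Finset.mem_univ _)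
      rw [h, map_zero, le_zero_iff, map_eq_zero] at this
      exact hi₁ this
    have hmem (j : T) : (i₀ : Place K).val (algebraMap L K (c j / c i₀)) ≤ 1 := by
      rw [val_le_one_iff]
      have hB : c j / c i₀ ∈ B := by
        rw [← B.valuation_le_one_iff, map_div₀]
        exact div_le_one_of_le₀ (hmax j (Finset.mem_univ _)) zero_le
      rw [← (hT i₀.2 : (i₀ : Place K).ring.comap (algebraMap L K) = B)] at hB
      exact hB
    have hsum' : ∑ j, algebraMap L K (c j / c i₀) * z j = 0 := by
      have := congrArg (fun y => algebraMap L K (c i₀)⁻¹ * y) hsum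
      simp only [Finset.mul_sum, mul_zero, Algebra.smul_def] at this
      rw [← this]
      refine Finset.sum_congr rfl fun j _ => ?_
      rw [div_eq_inv_mul, map_mul, mul_assoc]
    rw [← Finset.add_sum_erase _ _ (Finset.mem_univ i₀), div_self h0, map_one, one_mul] at hsum'
    have hv : (i₀ : Place K).val (z i₀) < 1 := by
      rw [eq_neg_of_add_eq_zero_left hsum', Valuation.map_neg]
      refine Valuation.map_sum_lt _ one_ne_zero fun j hj => ?_
      rw [map_mul]
      exact mul_lt_one_of_nonneg_of_lt_one_right (hmem j) zero_le (hz j i₀ (Finset.ne_of_mem_erase hj).symm)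
    exact hv.ne (hz1 i₀)
  have := hli.fintype_card_le_finrank
  omega

section FunctionField

variable (F : Type*) [Field F] [Algebra F⟮X⟯ K]

lemma comap_ring_eq (p : Place K) : (p.val.comap (algebraMap F⟮X⟯ K)).valuationSubring =
    p.ring.comap (algebraMap F⟮X⟯ K) := by
  ext x
  rw [Valuation.mem_valuationSubring_iff, Valuation.comap_apply, val_le_one_iff]
  rfl

variable [Finite F]

/-- The valuation induced by `p` on a rational function field over a finite field is trivial on the
constants. -/
lemma isTrivialOn_comap (p : Place K) :
    (p.val.comap (algebraMap F⟮X⟯ K)).IsTrivialOn F := by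
  refine ⟨fun a ha => ?_⟩
  have : Fintype F := Fintype.ofFinite F
  have h : (p.val.comap (algebraMap F⟮X⟯ K)) (algebraMap F F⟮X⟯ a) ^ (Fintype.card F - 1) = 1 := by
    rw [← map_pow, ← map_pow, FiniteField.pow_card_sub_one_eq_one a ha, map_one, map_one]
  have h0 : Fintype.card F - 1 ≠ 0 := by
    have := Fintype.one_lt_card (α := F)
    omega
  exact (pow_eq_one_iff_of_nonneg zero_le h0).1 h

/-- A nonzero rational function is a unit at almost all places below a place of `K`. -/
lemma finite_places_ratFunc (c : F⟮X⟯) (hc : c ≠ 0) :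
    {B : ValuationSubring F⟮X⟯ | ∃ p : Place K, p.ring.comap (algebraMap F⟮X⟯ K) = B ∧
      p.val (algebraMap F⟮X⟯ K c) ≠ 1}.Finite := by
  classical
  have hfin : ({u : HeightOneSpectrum F[X] | u.valuation F⟮X⟯ c ≠ 1}).Finite := by
    refine ((HeightOneSpectrum.Support.finite F[X] c).union
      (HeightOneSpectrum.Support.finite F[X] c⁻¹)).subset fun u hu => ?_
    rcases lt_or_gt_of_ne (hu : u.valuation F⟮X⟯ c ≠ 1) with h | h
    · right
      change 1 < u.valuation F⟮X⟯ c⁻¹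
      rw [map_inv₀]
      exact (one_lt_inv₀ (by simpa [zero_lt_iff] using hc)).2 h
    · left; exact h
  refine ((hfin.image fun u => (u.valuation F⟮X⟯).valuationSubring).union
    (Set.finite_singleton (RatFunc.inftyValuation F).valuationSubring)).subset ?_
  rintro B ⟨p, rfl, hp⟩
  let v := p.val.comap (algebraMap F⟮X⟯ K)
  have := isTrivialOn_comap F p
  have hvc : v c ≠ 1 := hp
  have hr : v.IsRankOneDiscrete := by
    have : Nontrivial (MonoidWithZeroHom.valueGroup (.ofClass v)) := by
      rw [Subgroup.nontrivial_iff_exists_ne_one]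
      have hvc0 : v c ≠ 0 := by simpa using hc
      refine ⟨Units.mk0 (v c) hvc0, MonoidWithZeroHom.mem_valueGroup _ ⟨c, rfl⟩, ?_⟩
      intro h
      exact hvc (by simpa using congrArg Units.val h)
    infer_instance
  rw [← comap_ring_eq F p]
  rcases (RatFunc.valuation_isEquiv_infty_or_adic (v := v)).or with h | ⟨u, hu, -⟩
  · right
    exact (Valuation.isEquiv_iff_valuationSubring _ _).1 h
  · left
    refine ⟨u, ?_, ((Valuation.isEquiv_iff_valuationSubring _ _).1 hu).symm⟩
    intro h
    exact hvc (hu.eq_one_iff_eq_one.2 h)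

/-- A nonzero element of a global function field is a unit at almost all places. -/
lemma finite_val_ne_one [FunctionField F K] (x : K) (hx : x ≠ 0) :
    {p : Place K | p.val x ≠ 1}.Finite := by
  have hint : IsIntegral F⟮X⟯ x := Algebra.IsIntegral.isIntegral x
  let f := minpoly F⟮X⟯ x
  let Bs : Set (ValuationSubring F⟮X⟯) := ⋃ i ∈ f.support,
    {B | ∃ p : Place K, p.ring.comap (algebraMap F⟮X⟯ K) = B ∧
      p.val (algebraMap F⟮X⟯ K (f.coeff i)) ≠ 1}
  have hBs : Bs.Finite := Set.Finite.biUnion f.support.finite_toSet fun i hi =>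
    finite_places_ratFunc F (f.coeff i) (Polynomial.mem_support_iff.1 hi)
  refine (hBs.biUnion fun B _ => finite_comap_eq (K := K) B).subset fun p hp => ?_
  simp only [Set.mem_iUnion]
  refine ⟨p.ring.comap (algebraMap F⟮X⟯ K), ?_, rfl⟩
  by_contra hcon
  simp only [Bs, Set.mem_iUnion, not_exists] at hcon
  have hco (i : ℕ) (hi : f.coeff i ≠ 0) : p.val (algebraMap F⟮X⟯ K (f.coeff i)) = 1 := by
    by_contra h
    exact hcon i (Polynomial.mem_support_iff.2 hi) ⟨p, rfl, h⟩
  have hco' (i : ℕ) : p.val (algebraMap F⟮X⟯ K (f.coeff i)) ≤ 1 := by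
    by_cases hi : f.coeff i = 0
    · simp [hi]
    · exact (hco i hi).le
  have hsum : ∑ i ∈ Finset.range (f.natDegree + 1),
      algebraMap F⟮X⟯ K (f.coeff i) * x ^ i = 0 := by
    rw [← Polynomial.aeval_eq_sum_range' (Nat.lt_succ_self _) x |>.trans
      (Finset.sum_congr rfl fun i _ => Algebra.smul_def _ _)]
    exact minpoly.aeval _ _
  rcases lt_or_gt_of_ne hp with h | h
  · rw [Finset.sum_range_succ', pow_zero, mul_one] at hsum
    have h1 := hco 0 (minpoly.coeff_zero_ne_zero hint hx)
    rw [eq_neg_of_add_eq_zero_right hsum, Valuation.map_neg] at h1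
    refine (Valuation.map_sum_lt _ one_ne_zero fun i _ => ?_).ne h1
    rw [map_mul, map_pow]
    exact mul_lt_one_of_nonneg_of_lt_one_right (hco' _) zero_le (pow_lt_one₀ zero_le h (Nat.succ_ne_zero i))
  · have hmon : f.coeff f.natDegree = 1 := minpoly.monic hint
    rw [Finset.sum_range_succ, hmon, map_one, one_mul] at hsum
    have h2 : p.val (x ^ f.natDegree) < p.val (x ^ f.natDegree) := by
      conv_lhs => rw [eq_neg_of_add_eq_zero_right hsum, Valuation.map_neg]
      refine Valuation.map_sum_lt _ (by simpa using fun h => absurd h hx) fun i hi => ?_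
      rw [map_mul, map_pow, map_pow]
      exact (mul_le_of_le_one_left zero_le (hco' i)).trans_lt
        (pow_lt_pow_right₀ h (Finset.mem_range.1 hi))
    exact h2.false

end FunctionField

end Place

/-- The idele group of `K`: the restricted product of the groups `K_pˣ` over all places `p`
with respect to the unit groups `U_p`. -/
abbrev Ideles (K : Type*) [Field K] : Type _ :=
  Πʳ p : Place K, [(p.Completion)ˣ, p.oneUnits 0]

section

variable (F K : Type*) [Field F] [Finite F] [Field K] [Algebra F⟮X⟯ K] [FunctionField F K]

/-- The diagonal embedding of `Kˣ` into the idele group. -/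
noncomputable def principalIdele : Kˣ →* Ideles K where
  toFun x := ⟨fun p => Units.map (p.toCompletion : K →* p.Completion) x, by
    refine (Place.finite_val_ne_one F (x : K) x.ne_zero).subset fun p hp hv => hp ?_
    exact (p.mem_oneUnits_zero _).2 ((p.v_toCompletion x).trans hv)⟩
  map_one' := RestrictedProduct.ext _ _ fun p =>
    map_one (Units.map (p.toCompletion : K →* p.Completion))
  map_mul' x y := RestrictedProduct.ext _ _ fun p =>
    map_mul (Units.map (p.toCompletion : K →* p.Completion)) x y

/-- The idele class group of `K`. -/
abbrev IdeleClassGroup : Type _ := Ideles K ⧸ (principalIdele F K).range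

end

section

variable {K : Type*} [Field K] (S : Set (Place K)) (m : Place K →₀ ℕ)

/-- An `S`-cycle is an effective divisor whose support is disjoint from `S`. -/
def IsCycle : Prop := Disjoint (m.support : Set (Place K)) S

/-- The `S`-congruence subgroup mod `m` of the idele group. -/
noncomputable def congruenceSubgroup : Subgroup (Ideles K) where
  carrier := {a | ∀ p ∉ S, a p ∈ p.oneUnits (m p)}
  one_mem' _ _ := one_mem _
  mul_mem' ha hb p hp := mul_mem (ha p hp) (hb p hp)
  inv_mem' ha p hp := inv_mem (ha p hp)

lemma congruenceSubgroup_le : congruenceSubgroup S m ≤ congruenceSubgroup S 0 :=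
  fun _ ha p hp => (p.mem_oneUnits_zero _).2 (ha p hp).1

/-- The ring of all functions in `K` with poles only in `S`. -/
def ringOfSIntegers : Subring K := ⨅ p ∈ Sᶜ, p.ring.toSubring

lemma val_unit_eq_one (u : (ringOfSIntegers S)ˣ) (p : Place K) (hp : p ∉ S) :
    p.val ((u : ringOfSIntegers S) : K) = 1 := by
  have key (y : ringOfSIntegers S) : p.val (y : K) ≤ 1 := by
    rw [p.val_le_one_iff]
    have h := y.2
    simp only [ringOfSIntegers, Subring.mem_iInf] at h
    exact h p hp
  refine le_antisymm (key _) ?_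
  have h : p.val ((u : ringOfSIntegers S) : K) * p.val ((u⁻¹ : (ringOfSIntegers S)ˣ) : ringOfSIntegers S) = 1 := by
    rw [← map_mul, ← Subring.coe_mul, Units.mul_inv, Subring.coe_one, map_one]
  rw [← h]
  exact mul_le_of_le_one_right zero_le (key _)

end

section

variable (F : Type*) {K : Type*} [Field F] [Finite F] [Field K] [Algebra F⟮X⟯ K] [FunctionField F K]
  (S : Set (Place K)) (m : Place K →₀ ℕ)

/-- The `S`-congruence subgroup mod `m` of the idele class group: the image of the `S`-congruence
subgroup of the idele group. -/
noncomputable def classCongruenceSubgroup : Subgroup (IdeleClassGroup F K) :=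
  (congruenceSubgroup S m).map (QuotientGroup.mk' (principalIdele F K).range)

/-- The diagonal embedding of the units of the ring of `S`-integers into the `S`-congruence
subgroup mod `0`. -/
noncomputable def unitsToCongruenceSubgroup : (ringOfSIntegers S)ˣ →* congruenceSubgroup S 0 :=
  ((principalIdele F K).comp (Units.map ((ringOfSIntegers S).subtype : ringOfSIntegers S →* K))).codRestrict _ 
    fun u p hp => (p.mem_oneUnits_zero _).2
      ((p.v_toCompletion _).trans (val_unit_eq_one S u p hp))

/-- The group `I / Kˣ I_S^m`. -/
abbrev RayQuotient : Type _ := Ideles K ⧸ ((principalIdele F K).range ⊔ congruenceSubgroup S m)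

/-- The natural map from `S`-units to `I_S^0 / I_S^m`, given by the diagonal embedding. -/
noncomputable def rayMap₁ :
    (ringOfSIntegers S)ˣ →*
      congruenceSubgroup S 0 ⧸ (congruenceSubgroup S m).subgroupOf (congruenceSubgroup S 0) :=
  (QuotientGroup.mk' _).comp (unitsToCongruenceSubgroup F S)

/-- The map from `I_S^0 / I_S^m` to `I / Kˣ I_S^m` induced by the inclusion. -/
noncomputable def rayMap₂ :
    congruenceSubgroup S 0 ⧸ (congruenceSubgroup S m).subgroupOf (congruenceSubgroup S 0) →*
      RayQuotient F S m :=
  QuotientGroup.map _ _ (congruenceSubgroup S 0).subtype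
    fun _ ha => Subgroup.mem_sup_right ha

/-- The canonical projection from `I / Kˣ I_S^m` to `I / Kˣ I_S^0`. -/
noncomputable def rayMap₃ : RayQuotient F S m →* RayQuotient F S 0 :=
  QuotientGroup.map _ _ (MonoidHom.id (Ideles K))
    (sup_le_sup_left (congruenceSubgroup_le S m) _)

end

/-! Exactness is formal once a principal idèle in $\mathcal I_S^{\mathfrak o}$ is seen to come from
a unit of $\mathcal O_S$. For the index, $(\mathcal I_S^{\mathfrak o}:\mathcal I_S^{\mathfrak m})$
is finite because only the support of `m` matters and the residue rings are finite. The rest is the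
finiteness of the $S$-class group $\mathcal I/K^*\mathcal I_S^{\mathfrak o}$.

That is proved by counting elements instead of dimensions. Let $L(D)$ be the Riemann-Roch space `box
Set.univ D` and $N$ the absolute norm of divisors. If an $F$-subspace $R$ of $K$ is stable under
$x$, then $|R/xR|\le |F|^{[K:F(x)]}$ (`relIndex_mulLeft_le`); with weak approximation this bounds
the norm of the zeros of $x$ from above. The growth of $L(kP)$, for $P$ the pole divisor of $x$,
bounds $N(P)$ from below by the same number. The two bounds give the product formula
(`divNorm_zeros_inv`) and Riemann's inequality $N(E)\le C\,|L(E-E')|\,N(E')$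
(`exists_divNorm_le_card_box`).

For a place $\mathfrak p_0\in S$, changing a divisor by multiples of $\mathfrak p_0$ brings its norm
into a range where Riemann's inequality yields a nonzero function. So away from $\mathfrak p_0$ each
divisor is equivalent to an effective one of bounded norm (`exists_equiv_effective`), and there are
finitely many of these (`finite_divNorm_le`). -/

section RankBounds

/-! ### Subspaces stable under multiplication by `x`, and the degree over `F(x)` -/

open IntermediateField Polynomial algebraAdjoinAdjoin

variable {F K : Type*} [Field F] [Field K] [Algebra F K]

/-- A family that is independent over the polynomials in `x` is independent over `F(x)`. -/
lemma linearIndependent_adjoin_of_aeval {x : K} {ι : Type*} [Fintype ι] {u : ι → K}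
    (h : ∀ f : ι → F[X], ∑ i, aeval x (f i) * u i = 0 → ∀ i, f i = 0) :
    LinearIndependent F⟮x⟯ u := by
  rw [← LinearIndependent.iff_fractionRing (Algebra.adjoin F {x}) F⟮x⟯,
    Fintype.linearIndependent_iff]
  intro g hg
  have hex (i : ι) : ∃ f : F[X], aeval x f = (g i : K) := by
    obtain ⟨y, hy⟩ := g i
    rw [Algebra.adjoin_singleton_eq_range_aeval] at hy
    exact hy
  choose f hf using hex
  have h0 := h f (by
    rw [← hg]
    exact Finset.sum_congr rfl fun i _ => by rw [hf]; rfl)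
  intro i
  ext
  rw [← hf i, h0 i, map_zero]; rfl

/-- A submodule stable under multiplication by a transcendental `x` has at most `[K : F(x)]`
independent elements modulo `x`. -/
lemma rank_quotient_mulLeft_le {x : K} [FiniteDimensional F⟮x⟯ K]
    (R : Submodule F K) (hR : ∀ y ∈ R, x * y ∈ R) (hx : x ≠ 0) :
    Module.rank F (R ⧸ (R.map (LinearMap.mulLeft F x)).submoduleOf R) ≤
      Module.finrank F⟮x⟯ K := by
  refine rank_le fun s hs => ?_
  have hsurj := Submodule.Quotient.mk_surjective ((R.map (LinearMap.mulLeft F x)).submoduleOf R)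
  choose l hl using hsurj
  have hli : LinearIndependent F⟮x⟯ (fun i : s => ((l i : R) : K)) := by
    refine linearIndependent_adjoin_of_aeval fun f hf => ?_
    have hstab (g : F[X]) (y : K) (hy : y ∈ R) : aeval x g * y ∈ R := by
      induction g using Polynomial.induction_on' with
      | add p q hp hq => rw [map_add, add_mul]; exact R.add_mem hp hq
      | monomial n a =>
        rw [aeval_monomial, ← Algebra.smul_def, smul_mul_assoc]
        refine R.smul_mem _ ?_
        induction n with
        | zero => simpa using hy
        | succ n ih => rw [pow_succ', mul_assoc]; exact hR _ ih
    -- Descent: independence modulo `x` kills the constant terms of a relation, so the relation can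
    -- be divided by `x` and the argument repeated. A nonzero polynomial is not divisible by every
    -- power of `X`.
    have hdvd (k : ℕ) : ∀ f : s → F[X], ∑ i, aeval x (f i) * ((l i : R) : K) = 0 →
        ∀ i, X ^ k ∣ f i := by
      induction k with
      | zero => intro f _ i; simp
      | succ k ih =>
        intro f hf
        have hc : ∀ i, (f i).coeff 0 = 0 := by
          rw [Fintype.linearIndependent_iff] at hs
          refine hs (fun i => (f i).coeff 0) ?_
          have : ∑ i : s, (f i).coeff 0 • i.1 =
              Submodule.Quotient.mk (∑ i : s, (f i).coeff 0 • l i) := by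
            simp only [← Submodule.mkQ_apply, map_sum, map_smul]
            simp only [Submodule.mkQ_apply, hl]
          rw [this, Submodule.Quotient.mk_eq_zero]
          -- The relation vanishes, so its constant part is minus `x` times the part given by
          -- `divX`.
          refine ⟨-∑ i, aeval x (divX (f i)) * ((l i : R) : K),
            R.neg_mem (R.sum_mem fun i _ => hstab _ _ (l i).2), ?_⟩
          have hsplit : ∑ i, aeval x (f i) * ((l i : R) : K) =
              x * ∑ i, aeval x (divX (f i)) * ((l i : R) : K) +
                ∑ i, (f i).coeff 0 • ((l i : R) : K) := by
            rw [Finset.mul_sum, ← Finset.sum_add_distrib]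
            refine Finset.sum_congr rfl fun i _ => ?_
            conv_lhs => rw [← divX_mul_X_add (f i)]
            rw [map_add, map_mul, aeval_X, aeval_C, Algebra.smul_def]
            ring
          rw [hf] at hsplit
          simp only [LinearMap.mulLeft_apply, mul_neg, Submodule.coe_sum,
            Submodule.subtype_apply, Submodule.coe_smul]
          exact (eq_neg_of_add_eq_zero_right hsplit.symm).symm
        choose g hg using fun i => X_dvd_iff.2 (hc i)
        have h0 : ∑ i, aeval x (g i) * ((l i : R) : K) = 0 := by
          have : x * ∑ i, aeval x (g i) * ((l i : R) : K) = 0 := by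
            rw [← hf, Finset.mul_sum]
            refine Finset.sum_congr rfl fun i _ => ?_
            rw [hg i, map_mul, aeval_X, mul_assoc]
          exact (mul_eq_zero.1 this).resolve_left hx
        intro i
        rw [hg i, pow_succ']
        exact mul_dvd_mul_left _ (ih g h0 i)
    intro i
    by_contra hne
    have := natDegree_le_of_dvd (hdvd ((f i).natDegree + 1) f hf i) hne
    rw [natDegree_X_pow] at this
    omega
  simpa using hli.fintype_card_le_finrank

/-- A submodule stable under multiplication by `x` has finite index over its multiple by `x`,
bounded by `|F| ^ [K : F(x)]`. -/
lemma relIndex_mulLeft_le [Finite F] {x : K} [FiniteDimensional F⟮x⟯ K]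
    (R : Submodule F K) (hR : ∀ y ∈ R, x * y ∈ R) (hx : x ≠ 0) :
    (R.map (LinearMap.mulLeft F x)).toAddSubgroup.relIndex R.toAddSubgroup ≠ 0 ∧
    (R.map (LinearMap.mulLeft F x)).toAddSubgroup.relIndex R.toAddSubgroup ≤
      Nat.card F ^ Module.finrank F⟮x⟯ K := by
  have hr := rank_quotient_mulLeft_le R hR hx
  let N := (R.map (LinearMap.mulLeft F x)).submoduleOf R
  have hfin : Module.Finite F (R ⧸ N) :=
    Module.rank_lt_aleph0_iff.1 (hr.trans_lt Cardinal.natCast_lt_aleph0)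
  have hf : Module.finrank F (R ⧸ N) ≤ Module.finrank F⟮x⟯ K :=
    Module.finrank_le_of_rank_le hr
  have hcard : (R.map (LinearMap.mulLeft F x)).toAddSubgroup.relIndex R.toAddSubgroup =
      Nat.card (R ⧸ N) := rfl
  have : Finite (R ⧸ N) := Module.finite_of_finite F
  rw [hcard]
  refine ⟨Nat.card_pos.ne', ?_⟩
  rw [Module.natCard_eq_pow_finrank (K := F)]
  exact Nat.pow_le_pow_right Nat.card_pos hf

lemma ne_zero_of_transcendental {x : K} (hx : Transcendental F x) : x ≠ 0 := by
  rintro rfl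
  exact hx isAlgebraic_zero

lemma transcendental_inv {x : K} (hx : Transcendental F x) : Transcendental F x⁻¹ :=
  fun h => hx (by simpa using h.inv)

/-- `K` has a basis over `F(x)` consisting of elements integral over `F[x]`. -/
lemma exists_integral_basis {x : K} [FiniteDimensional F⟮x⟯ K] :
    ∃ e : Fin (Module.finrank F⟮x⟯ K) → K, LinearIndependent F⟮x⟯ e ∧
      ∀ i, IsIntegral (Algebra.adjoin F {x}) (e i) := by
  let b := Module.finBasis F⟮x⟯ K
  have halg : Algebra.IsAlgebraic (Algebra.adjoin F {x}) K :=
    (IsFractionRing.comap_isAlgebraic_iff (A := Algebra.adjoin F {x}) (K := F⟮x⟯) (C := K)).2 inferInstance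
  choose r hr0 hr using fun i => (halg.isAlgebraic (b i)).exists_integral_multiple
  refine ⟨fun i => r i • b i, ?_, hr⟩
  have hu (i) : algebraMap (Algebra.adjoin F {x}) F⟮x⟯ (r i) ≠ 0 := by
    simpa using hr0 i
  have := b.linearIndependent.units_smul (fun i => Units.mk0 _ (hu i))
  convert this using 1
  ext i
  simp [Units.smul_def, algebraMap_smul]

lemma sum_aeval_injective {x : K} (hx : Transcendental F x) {ι : Type*} [Fintype ι] {e : ι → K}
    (he : LinearIndependent F⟮x⟯ e) :
    Function.Injective fun f : ι → F[X] => ∑ i, aeval x (f i) * e i := by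
  intro f g hfg
  rw [Fintype.linearIndependent_iff] at he
  have hmem (f : F[X]) : aeval x f ∈ F⟮x⟯ := by
    apply algebra_adjoin_le_adjoin
    rw [Algebra.adjoin_singleton_eq_range_aeval]
    exact ⟨f, rfl⟩
  have := he (fun i => ⟨aeval x (f i - g i), hmem _⟩) (by
    simp only [Algebra.smul_def, map_sub]
    change ∑ i, (aeval x (f i) - aeval x (g i)) * e i = 0
    simp only [sub_mul, Finset.sum_sub_distrib]
    exact sub_eq_zero.2 hfg)
  funext i
  have hi : aeval x (f i - g i) = 0 := congrArg Subtype.val (this i)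
  exact sub_eq_zero.1 ((transcendental_iff.1 hx) _ hi)

end RankBounds

/-! ### Existence of zeros of transcendental elements -/

namespace Place

section Existence

open IntermediateField Polynomial

variable {F K : Type*} [Field F] [Finite F] [Field K] [Algebra F K]

lemma val_algebraMap (p : Place K) {a : F} (ha : a ≠ 0) : p.val (algebraMap F K a) = 1 := by
  have : Fintype F := Fintype.ofFinite F
  have h : p.val (algebraMap F K a) ^ (Fintype.card F - 1) = 1 := by
    rw [← map_pow, ← map_pow, FiniteField.pow_card_sub_one_eq_one a ha, map_one, map_one]
  have h0 : Fintype.card F - 1 ≠ 0 := by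
    have := Fintype.one_lt_card (α := F)
    omega
  exact (pow_eq_one_iff_of_nonneg zero_le h0).1 h

lemma val_algebraMap_le_one (p : Place K) (a : F) : p.val (algebraMap F K a) ≤ 1 := by
  by_cases ha : a = 0
  · simp [ha]
  · exact (p.val_algebraMap ha).le

lemma val_aeval_le_one (p : Place K) {x : K} (hx : p.val x ≤ 1) (f : F[X]) :
    p.val (aeval x f) ≤ 1 := by
  rw [aeval_eq_sum_range]
  refine Valuation.map_sum_le _ fun i _ => ?_
  rw [Algebra.smul_def, map_mul, map_pow]
  exact mul_le_one' (p.val_algebraMap_le_one _) (pow_le_one' hx _)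

/-- The valuation ring contains `F[x]` and is integrally closed. -/
lemma val_le_one_of_isIntegral (p : Place K) {x y : K} (hx : p.val x ≤ 1)
    (hy : IsIntegral (Algebra.adjoin F {x}) y) : p.val y ≤ 1 := by
  rw [val_le_one_iff]
  have hle (a : Algebra.adjoin F {x}) : (a : K) ∈ p.ring := by
    obtain ⟨a, ha⟩ := a
    rw [Algebra.adjoin_singleton_eq_range_aeval] at ha
    obtain ⟨f, rfl⟩ := ha
    exact (p.val_le_one_iff _).1 (p.val_aeval_le_one hx f)
  obtain ⟨f, hf, hfy⟩ := hy
  have hint : IsIntegral p.ring y := by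
    let φ : Algebra.adjoin F {x} →+* p.ring :=
      { toFun := fun a => ⟨a, hle a⟩
        map_one' := rfl
        map_mul' := fun _ _ => rfl
        map_zero' := rfl
        map_add' := fun _ _ => rfl }
    refine ⟨f.map φ, hf.map φ, ?_⟩
    rw [eval₂_map]
    exact hfy
  obtain ⟨z, rfl⟩ := IsIntegrallyClosed.isIntegral_iff.1 hint
  exact z.2

lemma transcendental_of_val_ne_one (p : Place K) {x : K} (hx0 : x ≠ 0) (hx : p.val x ≠ 1) :
    Transcendental F x := by
  intro halg
  have key (y : K) (hy : IsAlgebraic F y) : p.val y ≤ 1 :=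
    -- Taking `x := 0` reduces the base ring `F[x]` to the constants.
    p.val_le_one_of_isIntegral (F := F) (x := 0) (by simp) (hy.isIntegral.tower_top)
  refine hx (le_antisymm (key x halg) ?_)
  have := key x⁻¹ halg.inv
  rw [map_inv₀] at this
  exact (inv_le_one₀ (by simpa [zero_lt_iff] using hx0)).1 this

/-- Every transcendental element has a zero. -/
lemma exists_val_lt_one_of_transcendental {t : K} [FiniteDimensional F⟮t⟯ K]
    (ht : Transcendental F t) : ∃ p : Place K, p.val t < 1 := by
  have ht0 := ne_zero_of_transcendental ht
  let A := Algebra.adjoin F {t}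
  let τ : A := ⟨t, Algebra.self_mem_adjoin_singleton F t⟩
  have hI : Ideal.span {τ} ≠ ⊤ := by
    intro h
    obtain ⟨a, ha⟩ := isUnit_iff_exists_inv.1 (Ideal.span_singleton_eq_top.1 h)
    obtain ⟨a, ha'⟩ := a
    obtain ⟨f, rfl⟩ : a ∈ (aeval t : F[X] →ₐ[F] K).range :=
      Algebra.adjoin_singleton_eq_range_aeval F t ▸ ha'
    have h1 : aeval t (X * f - 1) = 0 := by
      have := congrArg Subtype.val ha
      rw [map_sub, map_mul, aeval_X, map_one, sub_eq_zero]
      exact this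
    have h2 := transcendental_iff.1 ht _ h1
    have := congrArg (coeff · 0) h2
    simp at this
  -- A valuation ring dominating `F[t]` at the proper ideal `(t)`; it remains to show that it is
  -- discrete.
  obtain ⟨V, hAV, hV⟩ := Ideal.image_subset_nonunits_valuationSubring (A := A.toSubring) _ hI
  have htm : t ∈ V.nonunits := hV ⟨τ, Ideal.mem_span_singleton_self _, rfl⟩
  have htV : V.valuation t < 1 := V.mem_nonunits_iff.1 htm
  have hAV' (f : F[X]) : aeval t f ∈ V := hAV (by
    change _ ∈ Algebra.adjoin F {t}
    rw [Algebra.adjoin_singleton_eq_range_aeval]; exact ⟨f, rfl⟩)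
  have hFV (a : F) : algebraMap F K a ∈ V := by simpa using hAV' (C a)
  let R : Submodule F K :=
    { carrier := V
      add_mem' := V.add_mem _ _
      zero_mem' := V.zero_mem
      smul_mem' := fun a y hy => by rw [Algebra.smul_def]; exact V.mul_mem _ _ (hFV a) hy }
  have hR (k : ℕ) : ∀ y ∈ R, t ^ k * y ∈ R := fun y hy => by
    refine V.mul_mem _ _ ?_ hy
    simpa using hAV' (X ^ k)
  -- `f(t)` differs from the nonzero constant `f(0)` by a multiple of the nonunit `t`.
  have hunit (f : F[X]) (hf : f.coeff 0 ≠ 0) : (aeval t f)⁻¹ ∈ V := by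
    have hfac : aeval t f = t * aeval t (divX f) + algebraMap F K (f.coeff 0) := by
      conv_lhs => rw [← divX_mul_X_add f]
      rw [map_add, map_mul, aeval_X, aeval_C, mul_comm]
    have h1 : V.valuation (algebraMap F K (f.coeff 0)) = 1 := by
      refine le_antisymm ((V.valuation_le_one_iff _).2 (hFV _)) ?_
      have h := (V.valuation_le_one_iff _).2 (hFV (f.coeff 0)⁻¹)
      rw [map_inv₀, map_inv₀] at h
      exact (inv_le_one₀ (by simpa [zero_lt_iff] using hf)).1 h
    have h2 : V.valuation (aeval t f) = 1 := by
      rw [hfac]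
      refine (Valuation.map_add_eq_of_lt_right _ ?_).trans h1
      rw [h1, map_mul]
      exact mul_lt_one_of_nonneg_of_lt_one_left zero_le htV ((V.valuation_le_one_iff _).2 (hAV' _))
    rw [← V.valuation_le_one_iff, map_inv₀, h2, inv_one]
  -- Being algebraic over `F[t]`, `y` divides some nonzero `f(t) = t ^ k * g(t)` with `g(0) ≠ 0`,
  -- and `g(t)` is a unit of `V`.
  have hpow (y : V) (hy : y ≠ 0) : ∃ k : ℕ, ∃ z : V, t ^ k = y * z := by
    have hy0 : (y : K) ≠ 0 := by simpa using hy
    let _ : Algebra A V := (Subring.inclusion hAV).toAlgebra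
    have : IsScalarTower A V K := IsScalarTower.of_algebraMap_eq fun _ => rfl
    have halg : IsAlgebraic A y := by
      rw [← isAlgebraic_algebraMap_iff (A := K) Subtype.val_injective]
      open algebraAdjoinAdjoin in
      have halg : Algebra.IsAlgebraic A K :=
        (IsFractionRing.comap_isAlgebraic_iff (A := A) (K := F⟮t⟯) (C := K)).2 inferInstance
      exact halg.isAlgebraic _
    obtain ⟨⟨a, ha⟩, ha0, b, hab⟩ := halg.exists_nonzero_dvd (mem_nonZeroDivisors_of_ne_zero hy)
    have hab' : a = y * b := congrArg Subtype.val hab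
    obtain ⟨f, rfl⟩ : a ∈ (aeval t : F[X] →ₐ[F] K).range :=
      Algebra.adjoin_singleton_eq_range_aeval F t ▸ ha
    have hf0 : f ≠ 0 := by
      rintro rfl
      exact ha0 (Subtype.ext (map_zero _))
    obtain ⟨g, hg, hgd⟩ := exists_eq_pow_rootMultiplicity_mul_and_not_dvd f hf0 0
    rw [C_0, sub_zero] at hg hgd
    have hg0 : g.coeff 0 ≠ 0 := fun h => hgd (X_dvd_iff.2 h)
    have hgt : aeval t g ≠ 0 := fun h => hg0 (by rw [transcendental_iff.1 ht g h]; rfl)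
    refine ⟨rootMultiplicity 0 f, b * ⟨_, hunit g hg0⟩, ?_⟩
    push_cast
    rw [← mul_assoc, ← hab', eq_mul_inv_iff_mul_eq₀ hgt]
    change _ = aeval t f
    conv_rhs => rw [hg]
    simp
  let τ' : V := ⟨t, hAV τ.2⟩
  -- The index bound for `x`-stable subspaces, applied to `V` itself.
  have hfin : Finite (V ⧸ Ideal.span {τ'}) := by
    have h := (relIndex_mulLeft_le R (by simpa using hR 1) ht0).1
    let ψ : V →+ K := V.subtype
    have heq : (R.map (LinearMap.mulLeft F t)).toAddSubgroup.comap ψ =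
        (Ideal.span {τ'}).toAddSubgroup := by
      ext y
      constructor
      · rintro ⟨z, hz, hzy⟩
        exact Ideal.mem_span_singleton'.2 ⟨⟨z, hz⟩, Subtype.ext ((mul_comm _ _).trans hzy)⟩
      · intro hy
        obtain ⟨z, hz⟩ := Ideal.mem_span_singleton'.1 hy
        exact ⟨z, z.2, (mul_comm _ _).trans (congrArg Subtype.val hz)⟩
    change ((R.map (LinearMap.mulLeft F t)).toAddSubgroup.comap ψ).index ≠ 0 at h
    rw [heq] at h
    exact @AddSubgroup.finite_quotient_of_finiteIndex _ _ _ ⟨h⟩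
  have hquot (y : V) (hy : y ≠ 0) : Finite (V ⧸ Ideal.span {y}) := by
    obtain ⟨k, z, hz⟩ := hpow y hy
    have := Ideal.finite_quotient_pow (I := Ideal.span {τ'}) ⟨{τ'}, by simp⟩ k
    rw [Ideal.span_singleton_pow] at this
    refine Finite.of_surjective _ (Ideal.Quotient.factor_surjective (S := Ideal.span {τ' ^ k}) ?_)
    exact (Ideal.span_singleton_le_iff_mem _).2
      (Ideal.mem_span_singleton'.2 ⟨z, Subtype.ext ((mul_comm _ _).trans hz.symm)⟩)
  -- Finite quotients make `V` Noetherian, and a Noetherian valuation ring that is not a field is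
  -- discrete.
  have hfq : Ring.HasFiniteQuotients V := ⟨fun {I} hI => by
    obtain ⟨y, hyI, hy⟩ := Submodule.exists_mem_ne_zero_of_ne_bot hI
    have := hquot y hy
    exact Finite.of_surjective _ (Ideal.Quotient.factor_surjective
      ((Ideal.span_singleton_le_iff_mem I).2 hyI))⟩
  have hnf : ¬ IsField V := by
    intro h
    obtain ⟨b, hb⟩ := h.mul_inv_cancel (a := τ') (fun h => ht0 (congrArg Subtype.val h))
    have hb' : t * b = 1 := congrArg Subtype.val hb
    have := congrArg V.valuation hb'
    rw [map_mul, map_one] at this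
    exact (mul_lt_one_of_nonneg_of_lt_one_left zero_le htV (V.valuation_le_one b)).ne this
  have hiff : IsDiscreteValuationRing V ↔ ValuationRing V :=
    (IsDiscreteValuationRing.TFAE V hnf).out 0 1
  have hdvr : IsDiscreteValuationRing V := hiff.2 inferInstance
  refine ⟨⟨V, hdvr⟩, ?_⟩
  by_contra! h
  have hinv : t⁻¹ ∈ V := (val_le_one_iff ⟨V, hdvr⟩ _).1 (by rw [map_inv₀]; exact inv_le_one_of_one_le₀ h)
  rw [← V.valuation_le_one_iff, map_inv₀] at hinv
  exact htV.not_ge ((inv_le_one₀ (by simpa [zero_lt_iff] using ht0)).1 hinv)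

end Existence

end Place

/-! ### Boxes, weak approximation and norms of divisors -/

namespace Place

section Boxes

open WithZero

variable {K : Type*} [Field K]

/-- The logarithm of the valuation, i.e. minus the normalized additive valuation. -/
noncomputable def logVal (p : Place K) (x : K) : ℤ := log (p.val x)

lemma val_eq_exp_logVal (p : Place K) {x : K} (hx : x ≠ 0) : p.val x = exp (p.logVal x) :=
  (exp_log (by simpa using hx)).symm

lemma logVal_mul (p : Place K) {x y : K} (hx : x ≠ 0) (hy : y ≠ 0) :
    p.logVal (x * y) = p.logVal x + p.logVal y := by
  rw [logVal, map_mul, log_mul (by simpa using hx) (by simpa using hy)]; rfl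

lemma logVal_inv (p : Place K) (x : K) : p.logVal x⁻¹ = -p.logVal x := by
  rw [logVal, map_inv₀, log_inv]; rfl

lemma logVal_eq_of_val_eq (p : Place K) {x : K} {k : ℤ} (h : p.val x = exp k) : p.logVal x = k := by
  rw [logVal, h, log_exp]

lemma exists_val_eq_exp (p : Place K) (k : ℤ) : ∃ x : K, x ≠ 0 ∧ p.val x = exp k := by
  obtain ⟨x, hx⟩ := p.prime.valuation_exists_uniformizer K
  have hx' : p.val x = exp (-1 : ℤ) := hx
  have h : p.val (x ^ (-k)) = exp k := by
    rw [map_zpow₀, hx', ← exp_zsmul]; simp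
  refine ⟨x ^ (-k), ?_, h⟩
  intro h0
  rw [h0, map_zero] at h
  exact exp_ne_zero h.symm

/-- The elements of `K` bounded by `exp (D p)` at all places `p ∈ T`. -/
def box (T : Set (Place K)) (D : Place K → ℤ) : AddSubgroup K where
  carrier := {y | ∀ p ∈ T, p.val y ≤ exp (D p)}
  add_mem' ha hb p hp := Valuation.map_add_le _ (ha p hp) (hb p hp)
  zero_mem' p _ := by simp
  neg_mem' ha p hp := by simpa [Valuation.map_neg] using ha p hp

lemma box_mono {T : Set (Place K)} {D D' : Place K → ℤ} (h : ∀ p ∈ T, D p ≤ D' p) :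
    box T D ≤ box T D' :=
  fun _ hy p hp => (hy p hp).trans (exp_le_exp.2 (h p hp))

lemma box_congr {T : Set (Place K)} {D D' : Place K → ℤ} (h : ∀ p ∈ T, D p = D' p) :
    box T D = box T D' :=
  le_antisymm (box_mono fun p hp => (h p hp).le) (box_mono fun p hp => (h p hp).ge)

lemma box_anti {T T' : Set (Place K)} (h : T ⊆ T') (D : Place K → ℤ) : box T' D ≤ box T D :=
  fun _ hy p hp => hy p (h hp)

lemma map_mulLeft_box {T : Set (Place K)} {D D' : Place K → ℤ} {x : K} (hx : x ≠ 0)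
    (h : ∀ p ∈ T, D' p = p.logVal x + D p) :
    (box T D).map (AddMonoidHom.mulLeft x) = box T D' := by
  ext y
  constructor
  · rintro ⟨z, hz, rfl⟩ p hp
    change p.val (x * z) ≤ _
    rw [h p hp, map_mul, p.val_eq_exp_logVal hx, exp_add]
    exact mul_le_mul_right (hz p hp) _
  · intro hy
    refine ⟨x⁻¹ * y, fun p hp => ?_, mul_inv_cancel_left₀ hx y⟩
    rw [map_mul, map_inv₀, p.val_eq_exp_logVal hx, ← exp_neg]
    refine (mul_le_mul_right (hy p hp) _).trans ?_
    rw [← exp_add, h p hp, neg_add_cancel_left]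

lemma relIndex_box_translate {T : Set (Place K)} {D D' : Place K → ℤ} {x : K} (hx : x ≠ 0) :
    (box T fun p => p.logVal x + D p).relIndex (box T fun p => p.logVal x + D' p) =
      (box T D).relIndex (box T D') := by
  rw [← map_mulLeft_box hx (T := T) (D := D) fun _ _ => rfl,
    ← map_mulLeft_box hx (T := T) (D := D') fun _ _ => rfl]
  exact AddSubgroup.relIndex_map_map_of_injective _ _ (mul_right_injective₀ hx)

/-- The absolute norm of a place, i.e. the number of elements of its residue field. -/
noncomputable def absNorm (p : Place K) : ℕ :=
  (box {p} fun _ => -1).relIndex (box {p} fun _ => 0)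

/-- Each of the `n` steps is the index defining `absNorm`, translated by an element of suitable
valuation. -/
lemma relIndex_box_singleton (p : Place K) (n : ℕ) : ∀ {D D' : Place K → ℤ},
    D' p = D p + n → (box {p} D).relIndex (box {p} D') = p.absNorm ^ n := by
  induction n with
  | zero =>
    intro D D' h
    rw [box_congr (T := {p}) (D := D) (D' := D') (by rintro _ rfl; simp [h]), pow_zero,
      AddSubgroup.relIndex_self]
  | succ n ih =>
    intro D D' h
    rw [← AddSubgroup.relIndex_mul_relIndex _ (box {p} fun _ => D p + n) _
      (box_mono (by rintro _ rfl; simp)) (box_mono (by rintro _ rfl; rw [h]; push_cast; omega)),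
      ih rfl, pow_succ]
    congr 1
    obtain ⟨x, hx, hxp⟩ := p.exists_val_eq_exp (D' p)
    rw [absNorm, ← relIndex_box_translate (D := fun _ => -1) (D' := fun _ => 0) hx]
    have := p.logVal_eq_of_val_eq hxp
    congr 1
    · refine box_congr ?_
      rintro _ rfl
      rw [this, h]; push_cast; ring
    · refine box_congr ?_
      rintro _ rfl
      rw [this]; ring

/-- With `a` a unit at `p` and small elsewhere, and `s` small at `p` and a unit elsewhere, `a ^ N /
(a ^ N + s ^ N)` tends to 1 at `p` and to 0 at the other places. -/
lemma exists_cutoff (T : Finset (Place K)) {p : Place K} (hp : p ∈ T) (N : ℕ) :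
    ∃ e : K, p.val (e - 1) ≤ exp (-(N : ℤ)) ∧ ∀ q ∈ T, q ≠ p → q.val e ≤ exp (-(N : ℤ)) := by
  classical
  choose z hz1 hz using exists_separating (fun i : T => (i : Place K)) Subtype.val_injective
  have hle (p : Place K) (x : K) (hx : p.val x < 1) : p.val (x ^ N) ≤ exp (-(N : ℤ)) := by
    have : p.val x ≤ exp (-1 : ℤ) := by
      rw [← lt_mul_exp_iff_le exp_ne_zero, ← exp_add]; simpa using hx
    rw [map_pow]
    refine (pow_le_pow_left' this N).trans ?_
    rw [← exp_nsmul]; simp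
  let a := z ⟨p, hp⟩
  let s := ∑ i ∈ Finset.univ.erase (⟨p, hp⟩ : T), z i
  have ha : p.val a = 1 := hz1 ⟨p, hp⟩
  have ha' (q) (hq : q ∈ T) (hqp : q ≠ p) : q.val a < 1 :=
    hz ⟨p, hp⟩ ⟨q, hq⟩ (fun h => hqp (congrArg Subtype.val h))
  have hs : p.val s < 1 := by
    refine Valuation.map_sum_lt _ one_ne_zero fun i hi => ?_
    exact hz i ⟨p, hp⟩ (Finset.ne_of_mem_erase hi).symm
  have hs' (q) (hq : q ∈ T) (hqp : q ≠ p) : q.val s = 1 := by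
    have hmem : (⟨q, hq⟩ : T) ∈ Finset.univ.erase (⟨p, hp⟩ : T) :=
      Finset.mem_erase.2 ⟨fun h => hqp (congrArg Subtype.val h), Finset.mem_univ _⟩
    have h1 : q.val (z ⟨q, hq⟩) = 1 := hz1 ⟨q, hq⟩
    change q.val (∑ i ∈ _, z i) = 1
    rw [← Finset.add_sum_erase _ _ hmem]
    refine (Valuation.map_add_eq_of_lt_left _ ?_).trans h1
    rw [h1]
    refine Valuation.map_sum_lt _ one_ne_zero fun i hi => ?_
    exact hz i ⟨q, hq⟩ (Finset.ne_of_mem_erase hi).symm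
  -- For `N = 0` the denominator would be 2, possibly zero, so this case is separate.
  rcases Nat.eq_zero_or_pos N with rfl | hN
  · exact ⟨1, by simp, by simp⟩
  have hpN : p.val (a ^ N + s ^ N) = 1 := by
    refine (Valuation.map_add_eq_of_lt_left _ ?_).trans (by rw [map_pow, ha, one_pow])
    rw [map_pow, map_pow, ha, one_pow]
    exact pow_lt_one₀ zero_le hs hN.ne'
  refine ⟨a ^ N / (a ^ N + s ^ N), ?_, fun q hq hqp => ?_⟩
  · have h0 : a ^ N + s ^ N ≠ 0 := by
      intro h; rw [h, map_zero] at hpN; exact zero_ne_one hpN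
    have : a ^ N / (a ^ N + s ^ N) - 1 = -(s ^ N) / (a ^ N + s ^ N) := by
      field_simp; ring
    rw [this, map_div₀, hpN, div_one, Valuation.map_neg]
    exact hle p s hs
  · have hqN : q.val (a ^ N + s ^ N) = 1 := by
      refine (Valuation.map_add_eq_of_lt_right _ ?_).trans (by rw [map_pow, hs' q hq hqp, one_pow])
      rw [map_pow, map_pow, hs' q hq hqp, one_pow]
      exact pow_lt_one₀ zero_le (ha' q hq hqp) hN.ne'
    rw [map_div₀, hqN, div_one]
    exact hle q a (ha' q hq hqp)

lemma exists_approx (T : Finset (Place K)) {p : Place K} (hp : p ∈ T) (D : Place K → ℤ) (y : K) :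
    ∃ w : K, p.val (w - y) ≤ exp (D p) ∧ ∀ q ∈ T, q ≠ p → q.val w ≤ exp (D q) := by
  -- Large enough to absorb the poles of `y` and reach the accuracy `D q` at every place of `T`.
  let N : ℕ := ∑ q ∈ T, (q.logVal y - D q).toNat
  obtain ⟨e, he, he'⟩ := exists_cutoff T hp N
  have hN (q) (hq : q ∈ T) (a : K) (ha : q.val a ≤ exp (-(N : ℤ))) : q.val (y * a) ≤ exp (D q) := by
    have h1 : (q.logVal y - D q).toNat ≤ N :=
      Finset.single_le_sum (f := fun q : Place K => (q.logVal y - D q).toNat)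
        (fun _ _ => Nat.zero_le _) hq
    rw [map_mul]
    have h2 : q.val y ≤ exp (q.logVal y) := le_exp_log
    refine (mul_le_mul' h2 ha).trans ?_
    rw [← exp_add, exp_le_exp]
    omega
  refine ⟨y * e, ?_, fun q hq hqp => hN q hq _ (he' q hq hqp)⟩
  have : y * e - y = y * (e - 1) := by ring
  rw [this]
  exact hN p hp _ he

lemma box_add_single (T : Set (Place K)) {p : Place K} (hp : p ∈ T) (D : Place K → ℤ) (n : ℕ) :
    box T (fun q => D q + (Finsupp.single p n q : ℕ)) ⊓ box {p} D = box T D := by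
  classical
  ext y
  constructor
  · rintro ⟨h1, h2⟩ q hq
    by_cases hqp : q = p
    · subst hqp; exact h2 q rfl
    · have := h1 q hq
      simpa [Finsupp.single_eq_of_ne hqp] using this
  · intro h
    refine ⟨box_mono (fun q _ => by simp) h, ?_⟩
    rintro _ rfl
    exact h _ hp

/-- The quotient embeds into the corresponding quotient at `p` alone. `T` may be infinite, in
particular `Set.univ`. -/
lemma relIndex_box_add_single (T : Set (Place K)) (p : Place K) (hN : p.absNorm ≠ 0)
    (D : Place K → ℤ) (n : ℕ) :
    (box T D).relIndex (box T fun q => D q + (Finsupp.single p n q : ℕ)) ≠ 0 ∧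
    (box T D).relIndex (box T fun q => D q + (Finsupp.single p n q : ℕ)) ≤ p.absNorm ^ n := by
  classical
  by_cases hp : p ∈ T
  · have hle : box T (fun q => D q + (Finsupp.single p n q : ℕ)) ≤
        box {p} (fun q => D q + (Finsupp.single p n q : ℕ)) :=
      box_anti (by simpa using hp) _
    have hpow := relIndex_box_singleton p n (D := D)
      (D' := fun q => D q + (Finsupp.single p n q : ℕ)) (by simp)
    have hne : (box {p} D).relIndex (box {p} fun q => D q + (Finsupp.single p n q : ℕ)) ≠ 0 := by
      rw [hpow]; exact pow_ne_zero _ hN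
    rw [← box_add_single T hp D n, AddSubgroup.inf_relIndex_left, ← hpow]
    exact ⟨fun h => hne (AddSubgroup.relIndex_eq_zero_of_le_right hle h),
      AddSubgroup.relIndex_le_of_le_right hle hne⟩
  · have : box T (fun q => D q + (Finsupp.single p n q : ℕ)) = box T D :=
      box_congr fun q hq => by
        rw [Finsupp.single_eq_of_ne (by rintro rfl; exact hp hq)]; simp
    rw [this, AddSubgroup.relIndex_self]
    exact ⟨one_ne_zero, Nat.one_le_iff_ne_zero.2 (pow_ne_zero _ hN)⟩

/-- For finite `T`, weak approximation makes the embedding into the quotient at `p` surjective. -/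
lemma relIndex_box_add_single_eq (T : Finset (Place K)) {p : Place K} (hp : p ∈ T)
    (D : Place K → ℤ) (n : ℕ) :
    (box T D).relIndex (box T fun q => D q + (Finsupp.single p n q : ℕ)) = p.absNorm ^ n := by
  classical
  rw [← relIndex_box_singleton p n (D := D)
      (D' := fun q => D q + (Finsupp.single p n q : ℕ)) (by simp)]
  rw [← box_add_single T (Finset.mem_coe.2 hp) D n, AddSubgroup.inf_relIndex_left,
    ← AddSubgroup.relIndex_sup_right]
  congr 1
  refine le_antisymm (sup_le (box_anti (by simpa using hp) _) (box_mono fun q _ => by simp)) ?_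
  intro y hy
  obtain ⟨w, hw, hw'⟩ := exists_approx T hp D y
  refine AddSubgroup.mem_sup.2 ⟨w, fun q hq => ?_, y - w, ?_, by ring⟩
  · by_cases hqp : q = p
    · subst hqp
      have h : w = (w - y) + y := by ring
      rw [h]
      refine Valuation.map_add_le _ (hw.trans (exp_le_exp.2 (by simp))) (hy q rfl)
    · exact (hw' q hq hqp).trans (exp_le_exp.2 (by simp))
  · rintro _ rfl
    rwa [Valuation.map_sub_swap]

/-- The absolute norm of an effective divisor. -/
noncomputable def divNorm (E : Place K →₀ ℕ) : ℕ := E.prod fun p n => p.absNorm ^ n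

lemma divNorm_add (E E' : Place K →₀ ℕ) : divNorm (E + E') = divNorm E * divNorm E' :=
  Finsupp.prod_add_index' (fun _ => pow_zero _) fun _ _ _ => pow_add _ _ _

lemma divNorm_single (p : Place K) (n : ℕ) : divNorm (Finsupp.single p n) = p.absNorm ^ n :=
  Finsupp.prod_single_index (pow_zero _)

lemma divNorm_zero : divNorm (0 : Place K →₀ ℕ) = 1 := Finsupp.prod_zero_index

lemma divNorm_nsmul (k : ℕ) (E : Place K →₀ ℕ) : divNorm (k • E) = divNorm E ^ k := by
  induction k with
  | zero => rw [zero_smul, divNorm_zero, pow_zero]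
  | succ k ih => rw [succ_nsmul, divNorm_add, ih, pow_succ]

lemma relIndex_box_le (hN : ∀ p : Place K, p.absNorm ≠ 0) (T : Set (Place K)) (E : Place K →₀ ℕ)
    (D : Place K → ℤ) :
    (box T D).relIndex (box T fun q => D q + E q) ≠ 0 ∧
      (box T D).relIndex (box T fun q => D q + E q) ≤ divNorm E := by
  induction E using Finsupp.induction generalizing D with
  | zero => simp [divNorm_zero, AddSubgroup.relIndex_self]
  | single_add p n E _ _ ih =>
    have h1 := relIndex_box_add_single T p (hN p) D n
    have h2 := ih (fun q => D q + (Finsupp.single p n q : ℕ))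
    rw [divNorm_add, divNorm_single]
    have h3 := AddSubgroup.relIndex_mul_relIndex (box T D)
      (box T fun q => D q + (Finsupp.single p n q : ℕ))
      (box T fun q => D q + (Finsupp.single p n q : ℕ) + E q)
      (box_mono fun q _ => by simp) (box_mono fun q _ => by simp)
    have h4 : (box T fun q => D q + ((Finsupp.single p n + E : Place K →₀ ℕ) q : ℕ)) =
        box T fun q => D q + (Finsupp.single p n q : ℕ) + E q :=
      box_congr fun q _ => by rw [Finsupp.add_apply]; push_cast; ring
    rw [h4, ← h3]
    exact ⟨mul_ne_zero h1.1 h2.1, Nat.mul_le_mul h1.2 h2.2⟩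

lemma relIndex_box_eq (T : Finset (Place K)) (E : Place K →₀ ℕ) (hE : E.support ⊆ T)
    (D : Place K → ℤ) :
    (box T D).relIndex (box T fun q => D q + E q) = divNorm E := by
  classical
  induction E using Finsupp.induction generalizing D with
  | zero => simp [divNorm_zero, AddSubgroup.relIndex_self]
  | single_add p n E hp hn ih =>
    have hpT : p ∈ T := hE (by simp [hn])
    have hET : E.support ⊆ T := fun q hq => hE (by simp at hq ⊢; omega)
    have h1 := relIndex_box_add_single_eq T hpT D n
    have h2 := ih hET (fun q => D q + (Finsupp.single p n q : ℕ))
    rw [divNorm_add, divNorm_single]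
    have h3 := AddSubgroup.relIndex_mul_relIndex (box T D)
      (box T fun q => D q + (Finsupp.single p n q : ℕ))
      (box T fun q => D q + (Finsupp.single p n q : ℕ) + E q)
      (box_mono fun q _ => by simp) (box_mono fun q _ => by simp)
    have h4 : (box T fun q => D q + ((Finsupp.single p n + E : Place K →₀ ℕ) q : ℕ)) =
        box T fun q => D q + (Finsupp.single p n q : ℕ) + E q :=
      box_congr fun q _ => by rw [Finsupp.add_apply]; push_cast; ring
    rw [h4, ← h3, h1, h2]

end Boxes

end Place

/-! ### Divisors of functions and finiteness of residue fields -/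

namespace Place

lemma pow_sub_pow_ne_zero
    {F K : Type*} [Field F] [Field K] [Algebra F K] {x : K} (hx : Transcendental F x) {i j : ℕ} (hij : i < j) :
    x ^ j - x ^ i ≠ 0 := by
  intro h
  have h1 : Polynomial.aeval x (Polynomial.X ^ j - Polynomial.X ^ i : F[X]) = 0 := by simpa using h
  have h2 := congrArg (Polynomial.coeff · j) (transcendental_iff.1 hx _ h1)
  simp [Polynomial.coeff_X_pow, hij.ne'] at h2

section Divisors

open WithZero IntermediateField Polynomial

variable (F : Type*) {K : Type*} [Field F] [Finite F] [Field K] [Algebra F⟮X⟯ K]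
  [FunctionField F K]

/-- The divisor of zeros of `x`. -/
noncomputable def zeros (x : K) : Place K →₀ ℕ :=
  Finsupp.ofSupportFinite (fun p => (-p.logVal x).toNat) (by
    by_cases hx : x = 0
    · subst hx
      have : (fun p : Place K => (-p.logVal 0).toNat) = 0 := by
        funext p; simp [logVal]
      rw [this]; simp
    · refine (finite_val_ne_one F x hx).subset fun p hp h => hp ?_
      simp [logVal, h])

lemma zeros_apply (x : K) (p : Place K) : zeros F x p = (-p.logVal x).toNat := rfl

lemma zeros_inv_apply (x : K) (p : Place K) : zeros F x⁻¹ p = (p.logVal x).toNat := by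
  rw [zeros_apply, logVal_inv, neg_neg]

lemma logVal_eq_zeros_sub (x : K) (p : Place K) :
    p.logVal x = (zeros F x⁻¹ p : ℤ) - zeros F x p := by
  rw [zeros_inv_apply, zeros_apply]; omega

end Divisors

section Bounds

open WithZero IntermediateField Polynomial

variable (F : Type*) {K : Type*} [Field F] [Finite F] [Field K] [Algebra F K]

/-- Boxes are stable under constants. -/
def boxSubmodule (T : Set (Place K)) (D : Place K → ℤ) : Submodule F K where
  __ := box T D
  smul_mem' a y hy p hp := by
    rw [Algebra.smul_def, map_mul]
    exact (mul_le_of_le_one_left zero_le (p.val_algebraMap_le_one a)).trans (hy p hp)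

variable {F} in
/-- If `x` is integral at the places of `T`, a box over `T` has index at most `|F| ^ [K : F(x)]`
over its multiple by `x`. -/
lemma relIndex_box_logVal_le {x : K} [FiniteDimensional F⟮x⟯ K] (hx : x ≠ 0) (T : Set (Place K))
    (hT : ∀ p ∈ T, p.val x ≤ 1) :
    (box T fun p => p.logVal x).relIndex (box T fun _ => 0) ≠ 0 ∧
    (box T fun p => p.logVal x).relIndex (box T fun _ => 0) ≤
      Nat.card F ^ Module.finrank F⟮x⟯ K := by
  have h := relIndex_mulLeft_le (boxSubmodule F T fun _ => 0) (fun y hy p hp => by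
    rw [map_mul]
    exact (mul_le_of_le_one_left zero_le (hT p hp)).trans (hy p hp)) hx
  have heq : ((boxSubmodule F T fun _ => 0).map (LinearMap.mulLeft F x)).toAddSubgroup =
      box T fun p => p.logVal x :=
    map_mulLeft_box (D := fun _ => 0) hx (fun p _ => by simp)
  rw [heq] at h
  exact h

lemma one_lt_absNorm {p : Place K} (h : p.absNorm ≠ 0) : 1 < p.absNorm := by
  refine lt_of_le_of_ne (Nat.one_le_iff_ne_zero.2 h) fun h1 => ?_
  have := AddSubgroup.relIndex_eq_one.1 h1.symm (x := 1) (fun p _ => by simp) p rfl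
  rw [map_one, ← exp_zero, exp_le_exp] at this
  norm_num at this

/-- Among the first powers of an integral element two are congruent. -/
lemma exists_pow_sub_pow {p : Place K} (hN : p.absNorm ≠ 0) {x : K} (hx : p.val x ≤ 1) :
    ∃ i j : ℕ, i < j ∧ j ≤ p.absNorm ∧ p.val (x ^ j - x ^ i) < 1 := by
  let A : AddSubgroup K := box {p} fun _ => 0
  let B : AddSubgroup A := (box {p} fun _ => -1).addSubgroupOf A
  have hcard : Nat.card (A ⧸ B) = p.absNorm := rfl
  have : Finite (A ⧸ B) := Nat.finite_of_card_ne_zero (by rw [hcard]; exact hN)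
  have : Fintype (A ⧸ B) := Fintype.ofFinite _
  have hpow (i : ℕ) : x ^ i ∈ A := by
    rintro _ rfl
    rw [map_pow]
    exact pow_le_one' hx i
  -- Pigeonhole: one more power than there are residue classes.
  let g : Fin (p.absNorm + 1) → A ⧸ B := fun i => QuotientAddGroup.mk ⟨x ^ (i : ℕ), hpow i⟩
  have key (i j : Fin (p.absNorm + 1)) (h : g i = g j) : p.val (x ^ (j : ℕ) - x ^ (i : ℕ)) < 1 := by
    have h2 := QuotientAddGroup.eq.1 h p rfl
    have h3 : p.val (-x ^ (i : ℕ) + x ^ (j : ℕ)) ≤ exp (-1 : ℤ) := h2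
    rw [sub_eq_neg_add]
    refine h3.trans_lt ?_
    rw [← exp_zero, exp_lt_exp]; omega
  obtain ⟨i, j, hij, h⟩ := Fintype.exists_ne_map_eq_of_card_lt g (by
    rw [Fintype.card_fin, ← Nat.card_eq_fintype_card, hcard]; omega)
  rcases lt_or_gt_of_ne hij with hlt | hlt
  · exact ⟨i, j, hlt, by omega, key i j h⟩
  · exact ⟨j, i, hlt, by omega, key j i h.symm⟩

end Bounds

end Place

/-! ### Riemann-Roch spaces and the product formula -/

namespace Place

section RiemannRoch

open WithZero IntermediateField Polynomial FunctionField

/-- A uniformizer `x` is transcendental, so `[K : F(x)]` is finite and bounds the index of the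
maximal ideal. -/
lemma absNorm_ne_zero (F : Type*) {K : Type*} [Field F] [Finite F] [Field K]
    [Algebra F⟮X⟯ K] [FunctionField F K] [Algebra F K] [IsScalarTower F F⟮X⟯ K] (p : Place K) : p.absNorm ≠ 0 := by
  obtain ⟨x, hx0, hx⟩ := p.exists_val_eq_exp (-1)
  have ht : Transcendental F x := p.transcendental_of_val_ne_one hx0 (by
    rw [hx, ne_eq, exp_eq_one]; norm_num)
  have := finiteDimensional_of_adjoin_transcendental ht
  have h := (relIndex_box_logVal_le (F := F) hx0 {p} (by
    rintro _ rfl; rw [hx, ← exp_zero, exp_le_exp]; norm_num)).1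
  rwa [box_congr (T := {p}) (D' := fun _ => -1) (by
    rintro _ rfl; exact logVal_eq_of_val_eq _ hx)] at h

lemma divNorm_ne_zero (F : Type*) {K : Type*} [Field F] [Finite F] [Field K]
    [Algebra F⟮X⟯ K] [FunctionField F K] [Algebra F K] [IsScalarTower F F⟮X⟯ K] (E : Place K →₀ ℕ) : divNorm E ≠ 0 :=
  Finsupp.prod_ne_zero_iff.2 fun p _ => pow_ne_zero _ (absNorm_ne_zero F p)

/-- If `Q > P`, the powers of `Q / P` would outgrow the constant `c * P ^ s`. -/
lemma le_of_forall_pow_le {P Q c s : ℕ} (h : ∀ k, Q ^ (k + 1) ≤ c * P ^ (k + s)) (hP : P ≠ 0) :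
    Q ≤ P := by
  by_contra! hlt
  have hP0 : (0 : ℚ) < P := by exact_mod_cast Nat.pos_of_ne_zero hP
  have h1 : (1 : ℚ) < Q / P := by rw [one_lt_div hP0]; exact_mod_cast hlt
  obtain ⟨k, hk⟩ := pow_unbounded_of_one_lt ((c : ℚ) * P ^ s) h1
  have h2 : (Q : ℚ) ^ (k + 1) ≤ c * P ^ (k + s) := by exact_mod_cast h k
  rw [div_pow, lt_div_iff₀ (by positivity)] at hk
  have h3 : (Q : ℚ) ^ k ≤ Q ^ (k + 1) := by
    refine pow_le_pow_right₀ ?_ (Nat.le_succ k)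
    exact_mod_cast (show 1 ≤ Q by omega)
  have h4 : (c : ℚ) * P ^ (k + s) = c * P ^ s * P ^ k := by ring
  linarith

lemma card_box_mul_le (F : Type*) {K : Type*} [Field F] [Finite F] [Field K]
    [Algebra F⟮X⟯ K] [FunctionField F K] [Algebra F K] [IsScalarTower F F⟮X⟯ K] {T : Set (Place K)}
    (D : Place K → ℤ) (E : Place K →₀ ℕ) :
    Nat.card (box T fun p => D p + E p) ≤ Nat.card (box T D) * divNorm E := by
  have h := relIndex_box_le (absNorm_ne_zero F) T E D
  have h2 := AddSubgroup.relIndex_mul_relIndex ⊥ (box T D) (box T fun p => D p + E p) bot_le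
    (box_mono fun p _ => by simp)
  -- The index of `⊥` is `Nat.card`; both use the value 0 in the infinite case, so no finiteness is
  -- needed here.
  rw [AddSubgroup.relIndex_bot_left, AddSubgroup.relIndex_bot_left] at h2
  rw [← h2]
  exact Nat.mul_le_mul_left _ h.2

variable (F : Type*) {K : Type*} [Field F] [Finite F] [Field K] [Algebra F⟮X⟯ K]
  [FunctionField F K] [Algebra F K] [IsScalarTower F F⟮X⟯ K]

/-- Over the finite set of zeros of `x` the index of `xR` in `R` is exactly the norm, by
approximation, and the degree bounds it. -/
lemma divNorm_zeros_le {x : K} (hx : Transcendental F x) :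
    divNorm (zeros F x) ≤ Nat.card F ^ Module.finrank F⟮x⟯ K := by
  have := finiteDimensional_of_adjoin_transcendental hx
  have hx0 := ne_zero_of_transcendental hx
  have hneg (p : Place K) (hp : p ∈ (zeros F x).support) : p.logVal x < 0 := by
    rw [Finsupp.mem_support_iff, zeros_apply] at hp
    omega
  have h := (relIndex_box_logVal_le (F := F) hx0 ((zeros F x).support : Set (Place K)) (fun p hp => by
    rw [p.val_eq_exp_logVal hx0, ← exp_zero, exp_le_exp]
    exact (hneg p hp).le)).2
  rw [← relIndex_box_eq (zeros F x).support (zeros F x) subset_rfl fun p => p.logVal x]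
  convert h using 2
  refine box_congr fun p hp => ?_
  have := hneg p hp
  rw [zeros_apply]
  omega

variable {F}

/-- A transcendental `y` has a pole, namely a zero of `y⁻¹`; so functions without poles are
algebraic, hence constants. -/
lemma finite_box_zero (hF : algebraicClosure F K = ⊥) :
    ((box Set.univ fun _ => 0 : AddSubgroup K) : Set K).Finite := by
  refine (Set.finite_range (algebraMap F K)).subset fun y hy => ?_
  have halg : IsAlgebraic F y := by
    by_contra ht
    have hti : Transcendental F y⁻¹ := transcendental_inv ht
    have := finiteDimensional_of_adjoin_transcendental (F := F) hti
    obtain ⟨p, hp⟩ := exists_val_lt_one_of_transcendental hti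
    have hy1 : p.val y ≤ 1 := hy p trivial
    rw [map_inv₀] at hp
    exact hp.not_ge ((one_le_inv₀ (by simpa [zero_lt_iff] using ne_zero_of_transcendental ht)).2 hy1)
  have hmem : y ∈ algebraicClosure F K := mem_algebraicClosure_iff.2 halg
  rw [hF] at hmem
  exact IntermediateField.mem_bot.1 hmem

lemma finite_box (hF : algebraicClosure F K = ⊥) (E : Place K →₀ ℕ) :
    Finite (box Set.univ fun p => (E p : ℤ) : AddSubgroup K) := by
  have h := relIndex_box_le (absNorm_ne_zero F) Set.univ E fun _ => 0
  have h2 := AddSubgroup.relIndex_mul_relIndex ⊥ (box Set.univ fun _ => 0)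
    (box Set.univ fun p => (0 : ℤ) + E p) bot_le (box_mono fun p _ => by simp)
  rw [AddSubgroup.relIndex_bot_left, AddSubgroup.relIndex_bot_left] at h2
  have : Finite (box Set.univ fun _ => 0 : AddSubgroup K) := finite_box_zero hF
  have h3 : Nat.card (box Set.univ fun p => (0 : ℤ) + E p : AddSubgroup K) ≠ 0 := by
    rw [← h2]
    exact mul_ne_zero Nat.card_pos.ne' h.1
  simp only [zero_add] at h3
  exact Nat.finite_of_card_ne_zero h3

/-- The Riemann-Roch spaces of the multiples of a pole divisor grow as fast as possible. -/
lemma exists_pow_le_card_box (hF : algebraicClosure F K = ⊥) {x : K} (hx : Transcendental F x) :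
    ∃ s : ℕ, ∀ k : ℕ, (Nat.card F ^ Module.finrank F⟮x⟯ K) ^ (k + 1) ≤
      Nat.card (box Set.univ fun p => (((k + s) • zeros F x⁻¹) p : ℕ) : AddSubgroup K) := by
  have := finiteDimensional_of_adjoin_transcendental hx
  have hx0 := ne_zero_of_transcendental hx
  obtain ⟨e, he, hint⟩ := exists_integral_basis (F := F) (x := x)
  generalize Module.finrank F⟮x⟯ K = n at e he hint ⊢
  let P := zeros F x⁻¹
  -- Puts every `e i` into `L(sP)`: away from the poles of `x`, elements integral over `F[x]` have
  -- no poles.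
  let s : ℕ := ∑ p ∈ P.support, ∑ i, (p.logVal (e i)).toNat
  have hs (p : Place K) (i) : p.val (e i) ≤ exp ((s * P p : ℕ) : ℤ) := by
    by_cases hp : p ∈ P.support
    · have h1 : (p.logVal (e i)).toNat ≤ ∑ i, (p.logVal (e i)).toNat :=
        Finset.single_le_sum (f := fun i => (p.logVal (e i)).toNat)
          (fun _ _ => Nat.zero_le _) (Finset.mem_univ i)
      have h2 : ∑ i, (p.logVal (e i)).toNat ≤ s :=
        Finset.single_le_sum (f := fun p : Place K => ∑ i, (p.logVal (e i)).toNat)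
          (fun _ _ => Nat.zero_le _) hp
      have h3 : s ≤ s * P p :=
        Nat.le_mul_of_pos_right _ (Nat.pos_of_ne_zero (Finsupp.mem_support_iff.1 hp))
      refine le_exp_log.trans (exp_le_exp.2 ?_)
      change p.logVal (e i) ≤ _
      omega
    · have h0 : P p = 0 := by simpa using hp
      rw [h0, mul_zero, Nat.cast_zero, exp_zero]
      refine p.val_le_one_of_isIntegral (F := F) ?_ (hint i)
      rw [p.val_eq_exp_logVal hx0, ← exp_zero, exp_le_exp]
      have h1 : (p.logVal x).toNat = 0 := (zeros_inv_apply F x p).symm.trans h0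
      omega
  refine ⟨s, fun k => ?_⟩
  have hfin := finite_box hF ((k + s) • P)
  have hxP (p : Place K) : p.val x ≤ exp (P p : ℤ) := by
    rw [p.val_eq_exp_logVal hx0, exp_le_exp]
    have h1 : P p = (p.logVal x).toNat := zeros_inv_apply F x p
    omega
  have haeval (p : Place K) (f : F[X]) (hf : f ∈ degreeLT F (k + 1)) :
      p.val (aeval x f) ≤ exp ((k * P p : ℕ) : ℤ) := by
    rw [mem_degreeLT] at hf
    rw [aeval_eq_sum_range' (n := k + 1) (by
      by_cases h0 : f = 0
      · simp [h0]
      · exact (natDegree_lt_iff_degree_lt h0).2 hf)]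
    refine Valuation.map_sum_le _ fun i hi => ?_
    rw [Algebra.smul_def, map_mul, map_pow]
    refine (mul_le_of_le_one_left zero_le (p.val_algebraMap_le_one _)).trans ?_
    refine (pow_le_pow_left' (hxP p) i).trans ?_
    rw [← exp_nsmul, exp_le_exp, nsmul_eq_mul]
    push_cast
    have : i ≤ k := by simpa [Nat.lt_succ_iff] using hi
    gcongr
  -- Polynomial coefficients of degree at most `k` give `|F| ^ (n * (k + 1))` distinct elements of
  -- `L((k + s)P)`.
  let φ : (Fin n → degreeLT F (k + 1)) →
      (box Set.univ fun p => (((k + s) • P) p : ℕ) : AddSubgroup K) := fun f =>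
    ⟨∑ i, aeval x (f i : F[X]) * e i, fun p _ => by
      refine Valuation.map_sum_le _ fun i _ => ?_
      rw [map_mul]
      refine (mul_le_mul' (haeval p _ (f i).2) (hs p i)).trans ?_
      rw [← exp_add, exp_le_exp]
      simp only [Finsupp.smul_apply, smul_eq_mul]
      push_cast
      linarith⟩
  have hφ : Function.Injective φ := by
    intro f g hfg
    have h1 := sum_aeval_injective hx he (congrArg Subtype.val hfg)
    funext i
    exact Subtype.ext (congrFun h1 i)
  have hle := Nat.card_le_card_of_injective φ hφ
  refine le_trans (le_of_eq ?_) hle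
  rw [Nat.card_fun, Nat.card_congr (degreeLTEquiv F (k + 1)).toEquiv, Nat.card_fun, Nat.card_fin, Nat.card_fin,
    ← pow_mul, ← pow_mul, mul_comm]

/-- `L((k + s)P)` has at least `(|F| ^ [K : F(x)]) ^ (k + 1)` and at most `|L(0)| * N(P) ^ (k + s)`
elements; let `k` grow. -/
lemma le_divNorm_poles (hF : algebraicClosure F K = ⊥) {x : K} (hx : Transcendental F x) :
    Nat.card F ^ Module.finrank F⟮x⟯ K ≤ divNorm (zeros F x⁻¹) := by
  obtain ⟨s, hs⟩ := exists_pow_le_card_box hF hx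
  refine le_of_forall_pow_le (s := s) (c := Nat.card (box Set.univ fun _ => 0 : AddSubgroup K))
    (fun k => (hs k).trans ?_) (divNorm_ne_zero F _)
  have h := card_box_mul_le F (T := Set.univ) (fun _ => 0) ((k + s) • zeros F x⁻¹)
  rw [divNorm_nsmul] at h
  simpa only [zero_add] using h

/-- The product formula. -/
lemma divNorm_zeros_inv (hF : algebraicClosure F K = ⊥) {x : K} (hx : x ≠ 0) :
    divNorm (zeros F x⁻¹) = divNorm (zeros F x) := by
  by_cases ht : Transcendental F x
  · have hti := transcendental_inv ht
    -- The bounds for `x⁻¹` give one inequality and those for `x` the other, with no comparison of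
    -- the two degrees.
    have h1 := (divNorm_zeros_le F hti).trans (le_divNorm_poles hF hti)
    rw [inv_inv] at h1
    exact le_antisymm h1 ((divNorm_zeros_le F ht).trans (le_divNorm_poles hF ht))
  -- An algebraic element is a unit at every place, so both divisors vanish.
  · congr 1
    ext p
    have h1 : p.val x = 1 := by
      by_contra h
      exact ht (p.transcendental_of_val_ne_one hx h)
    rw [zeros_inv_apply, zeros_apply, logVal, h1, log_one]; rfl

end RiemannRoch

end Place

/-! ### Riemann's inequality and effective divisors of bounded norm -/

namespace Place

section RiemannInequality

open WithZero Polynomial FunctionField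

/-- A place of norm at most `B` is a pole of `x` or a zero of one of the finitely many `x ^ j - x ^
i` with `i < j ≤ B`. -/
lemma finite_absNorm_le (F : Type*) {K : Type*} [Field F] [Finite F] [Field K]
    [Algebra F⟮X⟯ K] [FunctionField F K] [Algebra F K] [IsScalarTower F F⟮X⟯ K]
    {x : K} (hx : Transcendental F x) (B : ℕ) :
    {p : Place K | p.absNorm ≤ B}.Finite := by
  have hx0 := ne_zero_of_transcendental hx
  refine ((finite_val_ne_one F x hx0).union (Set.Finite.biUnion (Finset.range (B + 1)).finite_toSet
    fun j _ => Set.Finite.biUnion (Finset.range j).finite_toSet fun i hi =>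
      finite_val_ne_one F (x ^ j - x ^ i)
        (pow_sub_pow_ne_zero hx (Finset.mem_range.1 hi)))).subset fun p hp => ?_
  by_cases h : p.val x ≤ 1
  · right
    obtain ⟨i, j, hij, hj, h2⟩ := exists_pow_sub_pow (absNorm_ne_zero F p) h
    simp only [Set.mem_iUnion, Finset.coe_range, Set.mem_Iio]
    exact ⟨j, Nat.lt_succ_of_le (hj.trans hp), i, hij, h2.ne⟩
  · left
    exact fun h1 => h h1.le

/-- There are only finitely many effective divisors of bounded norm. -/
lemma finite_divNorm_le (F : Type*) {K : Type*} [Field F] [Finite F] [Field K]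
    [Algebra F⟮X⟯ K] [FunctionField F K] [Algebra F K] [IsScalarTower F F⟮X⟯ K]
    {x : K} (hx : Transcendental F x) (B : ℕ) :
    {E : Place K →₀ ℕ | divNorm E ≤ B}.Finite := by
  classical
  have hfin := finite_absNorm_le F hx B
  refine (Set.finite_Icc (0 : Place K →₀ ℕ) (Finsupp.indicator hfin.toFinset fun _ _ => B)).subset
    fun E hE => ⟨zero_le, fun p => ?_⟩
  by_cases hp : E p = 0
  · rw [hp]; exact Nat.zero_le _
  have h1 : p.absNorm ^ E p ≤ B := by
    refine le_trans ?_ hE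
    exact Nat.le_of_dvd (Nat.pos_of_ne_zero (divNorm_ne_zero F E))
      (Finset.dvd_prod_of_mem (fun p => p.absNorm ^ E p) (Finsupp.mem_support_iff.2 hp))
  have h2 := one_lt_absNorm (absNorm_ne_zero F p)
  have hpm : p ∈ hfin.toFinset :=
    hfin.mem_toFinset.2 ((Nat.le_self_pow hp _).trans h1)
  rw [Finsupp.indicator_of_mem hpm]
  exact (Nat.lt_pow_self h2).le.trans h1

/-- Multiplication by `z` moves the poles allowed by `E` to the poles of `x`, so that `E` can be
compared with a multiple of the pole divisor. -/
lemma exists_logVal_add_nonpos (F : Type*) {K : Type*} [Field F] [Finite F] [Field K]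
    [Algebra F⟮X⟯ K] [FunctionField F K] [Algebra F K] [IsScalarTower F F⟮X⟯ K]
    {x : K} (hx : Transcendental F x) (E : Place K →₀ ℕ) :
    ∃ z : K, z ≠ 0 ∧ ∀ p : Place K, p.val x ≤ 1 → E p + p.logVal z ≤ 0 := by
  classical
  induction E using Finsupp.induction with
  | zero => exact ⟨1, one_ne_zero, fun p _ => by simp [logVal]⟩
  | single_add q n E _ _ ih =>
    obtain ⟨z, hz, h⟩ := ih
    by_cases hq : q.val x ≤ 1
    -- The factor `x ^ j - x ^ i` vanishes at `q` and is integral wherever `x` is.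
    · obtain ⟨i, j, hij, _, h2⟩ := exists_pow_sub_pow (absNorm_ne_zero F q) hq
      have hw := pow_sub_pow_ne_zero hx hij
      set w := x ^ j - x ^ i
      have hwn (p : Place K) (n : ℕ) : p.logVal (w ^ n) = n * p.logVal w := by
        rw [logVal, map_pow, log_pow]; simp [logVal]
      refine ⟨w ^ n * z, mul_ne_zero (pow_ne_zero _ hw) hz, fun p hp => ?_⟩
      rw [p.logVal_mul (pow_ne_zero _ hw) hz, hwn, Finsupp.add_apply]
      have h3 := h p hp
      by_cases hpq : p = q
      · subst hpq
        rw [Finsupp.single_eq_same]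
        have h4 : p.logVal w < 0 := by
          rwa [p.val_eq_exp_logVal hw, ← exp_zero, exp_lt_exp] at h2
        push_cast
        nlinarith
      · rw [Finsupp.single_eq_of_ne hpq]
        have h4 : p.logVal w ≤ 0 := by
          rw [← exp_le_exp, ← p.val_eq_exp_logVal hw, exp_zero]
          exact p.val.map_sub_le (by rw [map_pow]; exact pow_le_one' hp j)
            (by rw [map_pow]; exact pow_le_one' hp i)
        push_cast
        nlinarith
    · refine ⟨z, hz, fun p hp => ?_⟩
      rw [Finsupp.add_apply, Finsupp.single_eq_of_ne (by rintro rfl; exact hq hp), zero_add]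
      exact h p hp

variable {F K : Type*} [Field F] [Finite F] [Field K]
    [Algebra F⟮X⟯ K] [FunctionField F K] [Algebra F K] [IsScalarTower F F⟮X⟯ K]

/-- Riemann's inequality. -/
lemma exists_divNorm_le_card_box (hF : algebraicClosure F K = ⊥) {x : K}
    (hx : Transcendental F x) :
    ∃ C : ℕ, 0 < C ∧ ∀ E E' : Place K →₀ ℕ,
      divNorm E ≤ C * Nat.card (box Set.univ fun p => (E p : ℤ) - E' p : AddSubgroup K) *
        divNorm E' := by
  obtain ⟨s, hs⟩ := exists_pow_le_card_box hF hx
  have hx0 := ne_zero_of_transcendental hx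
  set P := zeros F x⁻¹ with hP
  have hPn : divNorm P ≠ 0 := divNorm_ne_zero F P
  refine ⟨divNorm P ^ s, Nat.pos_of_ne_zero (pow_ne_zero _ hPn), fun E E' => ?_⟩
  obtain ⟨z, hz, hzE⟩ := exists_logVal_add_nonpos F hx E
  let k : ℕ := ∑ p ∈ P.support, (E p + p.logVal z).toNat
  have hkP (p : Place K) : E p + p.logVal z ≤ (((k + s) • P) p : ℕ) := by
    rw [Finsupp.smul_apply, smul_eq_mul]
    by_cases hp : p ∈ P.support
    · have h1 : (E p + p.logVal z).toNat ≤ k :=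
        Finset.single_le_sum (f := fun p : Place K => (E p + p.logVal z).toNat)
          (fun _ _ => Nat.zero_le _) hp
      have h3 : k + s ≤ (k + s) * P p :=
        Nat.le_mul_of_pos_right _ (Nat.pos_of_ne_zero (Finsupp.mem_support_iff.1 hp))
      omega
    · refine (hzE p ?_).trans (Int.natCast_nonneg _)
      have h0 : P p = 0 := by simpa using hp
      have h1 : (p.logVal x).toNat = 0 := (zeros_inv_apply F x p).symm.trans h0
      rw [p.val_eq_exp_logVal hx0, ← exp_zero, exp_le_exp]
      omega
  have hlog := logVal_eq_zeros_sub F z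
  -- The gap between `(k + s)P` and the divisor of the space `z * L(E - E')`; it is effective by
  -- `hkP`, so the truncated subtraction is exact.
  let G : Place K →₀ ℕ := ((k + s) • P + E' + zeros F z) - (E + zeros F z⁻¹)
  have hG : G + (E + zeros F z⁻¹) = (k + s) • P + E' + zeros F z := by
    refine tsub_add_cancel_of_le fun p => ?_
    have h1 := hkP p
    rw [hlog] at h1
    simp only [Finsupp.add_apply]
    omega
  have hGn : divNorm G * divNorm E = divNorm ((k + s) • P) * divNorm E' := by
    have h1 := congrArg divNorm hG
    simp only [divNorm_add, divNorm_zeros_inv hF hz, ← mul_assoc] at h1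
    exact Nat.eq_of_mul_eq_mul_right (Nat.pos_of_ne_zero (divNorm_ne_zero F _)) h1
  have hcard : Nat.card (box Set.univ fun p => (((k + s) • P) p : ℕ) : AddSubgroup K) ≤
      Nat.card (box Set.univ fun p => (E p : ℤ) - E' p : AddSubgroup K) * divNorm G := by
    have h1 := card_box_mul_le F (T := Set.univ)
      (fun p => p.logVal z + ((E p : ℤ) - E' p)) G
    have h2 : Nat.card (box Set.univ fun p => p.logVal z + ((E p : ℤ) - E' p) : AddSubgroup K) =
        Nat.card (box Set.univ fun p => (E p : ℤ) - E' p : AddSubgroup K) := by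
      rw [← map_mulLeft_box hz (T := Set.univ) (D := fun p => (E p : ℤ) - E' p) fun _ _ => rfl]
      exact (Nat.card_congr (AddSubgroup.equivMapOfInjective _ _
        (mul_right_injective₀ hz)).toEquiv).symm
    rw [h2] at h1
    have h3 : (box Set.univ fun p => (((k + s) • P) p : ℕ) : AddSubgroup K) =
        box Set.univ fun p => p.logVal z + ((E p : ℤ) - E' p) + G p := by
      refine box_congr fun p _ => ?_
      have h3 := DFunLike.congr_fun hG p
      simp only [Finsupp.add_apply] at h3
      rw [hlog]
      omega
    rw [h3]
    exact h1
  have hle : divNorm ((k + s) • P) ≤ divNorm P ^ s *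
      Nat.card (box Set.univ fun p => (((k + s) • P) p : ℕ) : AddSubgroup K) := by
    rw [divNorm_nsmul, pow_add, mul_comm]
    refine Nat.mul_le_mul_left _ (le_trans ?_ (hs k))
    -- By the product formula the poles of `x` have the norm of its zeros, which is at most `|F| ^
    -- [K : F(x)]`.
    have h1 : divNorm P ≤ Nat.card F ^ Module.finrank (IntermediateField.adjoin F {x}) K := by
      rw [hP, divNorm_zeros_inv hF hx0]
      exact divNorm_zeros_le F hx
    calc divNorm P ^ k ≤ divNorm P ^ (k + 1) :=
          Nat.pow_le_pow_right (Nat.pos_of_ne_zero hPn) (Nat.le_succ k)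
      _ ≤ _ := Nat.pow_le_pow_left h1 _
  refine Nat.le_of_mul_le_mul_left (c := divNorm G) ?_ (Nat.pos_of_ne_zero (divNorm_ne_zero F G))
  rw [hGn]
  calc divNorm ((k + s) • P) * divNorm E' ≤ (divNorm P ^ s *
        (Nat.card (box Set.univ fun p => (E p : ℤ) - E' p : AddSubgroup K) * divNorm G)) *
          divNorm E' := Nat.mul_le_mul_right _ (hle.trans (Nat.mul_le_mul_left _ hcard))
    _ = _ := by ring

/-- Up to the place `p₀`, every divisor is equivalent to an effective divisor of bounded norm. -/
lemma exists_equiv_effective (hF : algebraicClosure F K = ⊥) (p₀ : Place K) :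
    ∃ B : ℕ, ∀ E E' : Place K →₀ ℕ, ∃ y : K, y ≠ 0 ∧ ∃ G : Place K →₀ ℕ, divNorm G ≤ B ∧
      ∀ p ≠ p₀, p.logVal y = (E p : ℤ) - E' p - G p := by
  classical
  obtain ⟨x, hx0, hx1⟩ := p₀.exists_val_lt_one
  have hx : Transcendental F x := p₀.transcendental_of_val_ne_one hx0 hx1.ne
  obtain ⟨C, hC, h⟩ := exists_divNorm_le_card_box hF hx
  have hq := one_lt_absNorm (absNorm_ne_zero F p₀)
  set q := p₀.absNorm
  refine ⟨C * q, fun E E' => ?_⟩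
  have hE' := Nat.pos_of_ne_zero (divNorm_ne_zero F E')
  have hE := Nat.pos_of_ne_zero (divNorm_ne_zero F E)
  -- A multiple of `p₀` so large that `a = 0` also satisfies the upper bound; hence a minimal `a ≥
  -- 0` works.
  let b := divNorm E
  have hb : divNorm E ≤ C * (divNorm E' * q ^ b) :=
    (Nat.lt_pow_self hq).le.trans (by
      rw [← mul_assoc]
      exact Nat.le_mul_of_pos_left _ (Nat.mul_pos hC hE'))
  have hex : ∃ a, C * (divNorm E' * q ^ b) < divNorm E * q ^ a :=
    ⟨C * (divNorm E' * q ^ b), (Nat.lt_pow_self hq).trans_le (Nat.le_mul_of_pos_left _ hE)⟩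
  obtain ⟨a, ha, hmin⟩ : ∃ a, C * (divNorm E' * q ^ b) < divNorm E * q ^ a ∧
      divNorm E * q ^ a ≤ C * (divNorm E' * q ^ b) * q := by
    refine ⟨Nat.find hex, Nat.find_spec hex, ?_⟩
    cases hf : Nat.find hex with
    | zero =>
      rw [pow_zero, mul_one]
      exact hb.trans (Nat.le_mul_of_pos_right _ (by omega))
    | succ n =>
      have := Nat.find_min hex (m := n) (by omega)
      rw [pow_succ, ← mul_assoc]
      exact Nat.mul_le_mul_right _ (not_lt.1 this)
  obtain ⟨E₁, h₁⟩ : ∃ E₁, E₁ = E + Finsupp.single p₀ a := ⟨_, rfl⟩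
  obtain ⟨E₂, h₂⟩ : ∃ E₂, E₂ = E' + Finsupp.single p₀ b := ⟨_, rfl⟩
  have hE₁ : divNorm E₁ = divNorm E * q ^ a := by rw [h₁, divNorm_add, divNorm_single]
  have hE₂ : divNorm E₂ = divNorm E' * q ^ b := by rw [h₂, divNorm_add, divNorm_single]
  have hR := h E₁ E₂
  -- If `L(E₁ - E₂)` were zero, it would have one element and Riemann's inequality would contradict
  -- the choice of `a`.
  have hne : ∃ y ∈ (box Set.univ fun p => (E₁ p : ℤ) - E₂ p : AddSubgroup K), y ≠ 0 := by
    by_contra! hcon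
    have hbot : (box Set.univ fun p => (E₁ p : ℤ) - E₂ p : AddSubgroup K) = ⊥ :=
      (AddSubgroup.eq_bot_iff_forall _).2 hcon
    rw [hbot, AddSubgroup.card_bot, mul_one, hE₁, hE₂] at hR
    omega
  obtain ⟨y, hy, hy0⟩ := hne
  have hylog (p : Place K) : p.logVal y ≤ (E₁ p : ℤ) - E₂ p := by
    rw [← exp_le_exp, ← p.val_eq_exp_logVal hy0]
    exact hy p trivial
  have hlog := logVal_eq_zeros_sub F y
  -- The divisor of `y` plus `E₁ - E₂`. By the product formula its norm is `N(E₁) / N(E₂)`.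
  let G : Place K →₀ ℕ := (E₁ + zeros F y) - (E₂ + zeros F y⁻¹)
  have hG : G + (E₂ + zeros F y⁻¹) = E₁ + zeros F y := by
    refine tsub_add_cancel_of_le fun p => ?_
    have h1 := hylog p
    rw [hlog] at h1
    simp only [Finsupp.add_apply] at h1 ⊢
    omega
  refine ⟨y, hy0, G, ?_, fun p hp => ?_⟩
  · have h1 := congrArg divNorm hG
    rw [divNorm_add, divNorm_add, divNorm_add, divNorm_zeros_inv hF hy0, ← mul_assoc] at h1
    have h2 := Nat.eq_of_mul_eq_mul_right (Nat.pos_of_ne_zero (divNorm_ne_zero F _)) h1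
    rw [hE₁, hE₂] at h2
    refine Nat.le_of_mul_le_mul_right (c := divNorm E' * q ^ b) ?_
      (Nat.mul_pos hE' (pow_pos (by omega) _))
    rw [h2]
    exact hmin.trans_eq (by ring)
  · have h1 := DFunLike.congr_fun hG p
    have h2 : E₁ p = E p := by
      rw [h₁, Finsupp.add_apply, Finsupp.single_eq_of_ne hp, add_zero]
    have h3 : E₂ p = E' p := by
      rw [h₂, Finsupp.add_apply, Finsupp.single_eq_of_ne hp, add_zero]
    simp only [Finsupp.add_apply, h2, h3] at h1
    rw [hlog]
    omega

end RiemannInequality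

end Place

/-! ### Local unit groups -/

namespace Place

section LocalUnits

open WithZero

variable {K : Type*} [Field K]

lemma exists_sub_toCompletion_le (p : Place K) (u : p.Completion) (n : ℕ) :
    ∃ y : K, Valued.v (u - p.toCompletion y) ≤ exp (-(n : ℤ)) := by
  -- Basic neighbourhoods are indexed by the value group, so the radius must be realized by an
  -- element.
  obtain ⟨t, ht0, ht⟩ := p.exists_val_eq_exp (-(n : ℤ))
  have htv : Valued.v (p.toCompletion t) = exp (-(n : ℤ)) := (p.v_toCompletion t).trans ht
  have hne : (Valued.v : Valuation p.Completion ℤᵐ⁰).restrict (p.toCompletion t) ≠ 0 := by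
    rw [Valuation.ne_zero_iff]
    intro h
    rw [h, map_zero] at htv
    exact exp_ne_zero htv.symm
  have hmem : {z : p.Completion | Valued.v (z - u) ≤ exp (-(n : ℤ))} ∈ nhds u := by
    rw [Valued.mem_nhds]
    refine ⟨Units.mk0 _ hne, fun z hz => ?_⟩
    have hz' : (Valued.v : Valuation p.Completion ℤᵐ⁰).restrict (z - u) <
      (Valued.v : Valuation p.Completion ℤᵐ⁰).restrict (p.toCompletion t) := hz
    rw [Valuation.restrict_lt_iff] at hz'
    exact (hz'.trans_eq htv).le
  obtain ⟨_, hz, y, rfl⟩ := mem_closure_iff_nhds.1 (HeightOneSpectrum.denseRange_algebraMap K p.prime u) _ hmem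
  exact ⟨y, by rw [Valuation.map_sub_swap]; exact hz⟩

/-- Approximating units by elements of `K` embeds the quotient, as a set, into the finite residue
ring modulo the `n`-th power of the maximal ideal. -/
lemma relIndex_oneUnits_ne_zero (F : Type*) [Field F] [Finite F]
    [Algebra F⟮X⟯ K] [FunctionField F K] [Algebra F K] [IsScalarTower F F⟮X⟯ K]
    (p : Place K) (n : ℕ) : (p.oneUnits n).relIndex (p.oneUnits 0) ≠ 0 := by
  let A : AddSubgroup K := box {p} fun _ => 0
  let B : AddSubgroup A := (box {p} fun _ => -(n : ℤ)).addSubgroupOf A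
  have hcard : Nat.card (A ⧸ B) = p.absNorm ^ n :=
    relIndex_box_singleton p n (D := fun _ => -(n : ℤ)) (D' := fun _ => 0) (by simp)
  have hfin : Finite (A ⧸ B) := Nat.finite_of_card_ne_zero (by
    rw [hcard]; exact pow_ne_zero _ (absNorm_ne_zero F p))
  choose y hy using fun u : p.oneUnits 0 =>
    p.exists_sub_toCompletion_le ((u : (p.Completion)ˣ) : p.Completion) n
  have hn : exp (-(n : ℤ)) ≤ (1 : ℤᵐ⁰) := by rw [← exp_zero, exp_le_exp]; omega
  have hyA (u) : y u ∈ A := by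
    intro q hq
    rw [Set.mem_singleton_iff.1 hq]
    rw [← v_toCompletion, exp_zero]
    have h : p.toCompletion (y u) = ((u : (p.Completion)ˣ) : p.Completion) -
        (((u : (p.Completion)ˣ) : p.Completion) - p.toCompletion (y u)) := by ring
    rw [h]
    exact Valuation.map_sub_le _ u.2.1.le ((hy u).trans hn)
  let g : (p.oneUnits 0) ⧸ (p.oneUnits n).subgroupOf (p.oneUnits 0) → A ⧸ B := fun c =>
    QuotientAddGroup.mk ⟨y c.out, hyA _⟩
  have hg : Function.Injective g := by
    intro c d hcd
    rw [← c.out_eq, ← d.out_eq]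
    refine QuotientGroup.eq.2 ?_
    set u := c.out
    set w := d.out
    have h1 : p.val (-y u + y w) ≤ exp (-(n : ℤ)) := QuotientAddGroup.eq.1 hcd p rfl
    rw [← v_toCompletion, map_add, map_neg] at h1
    have hmem : (u : (p.Completion)ˣ)⁻¹ * w ∈ p.oneUnits 0 := mul_mem (inv_mem u.2) w.2
    refine ⟨hmem.1, ?_⟩
    have hu : Valued.v (((u : (p.Completion)ˣ)⁻¹ : (p.Completion)ˣ) : p.Completion) = 1 :=
      (inv_mem u.2 : (u : (p.Completion)ˣ)⁻¹ ∈ p.oneUnits 0).1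
    have h2 : (((u : (p.Completion)ˣ)⁻¹ * w : (p.Completion)ˣ) : p.Completion) - 1 =
        (((u : (p.Completion)ˣ)⁻¹ : (p.Completion)ˣ) : p.Completion) *
          ((((w : (p.Completion)ˣ) : p.Completion) - p.toCompletion (y w)) -
            (((u : (p.Completion)ˣ) : p.Completion) - p.toCompletion (y u)) +
            (-p.toCompletion (y u) + p.toCompletion (y w))) := by
      rw [Units.val_mul, ← Units.inv_mul (u : (p.Completion)ˣ)]
      ring
    change Valued.v ((((u : (p.Completion)ˣ)⁻¹ * w : (p.Completion)ˣ) : p.Completion) - 1) ≤ _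
    rw [h2, map_mul, hu, one_mul]
    exact Valuation.map_add_le _ (Valuation.map_sub_le _ (hy w) (hy u)) h1
  have : Finite ((p.oneUnits 0) ⧸ (p.oneUnits n).subgroupOf (p.oneUnits 0)) :=
    Finite.of_injective g hg
  exact Nat.card_pos.ne'

end LocalUnits

end Place

/-! ### Exactness and finiteness for idèles -/

section Ideles

open WithZero Place

/-- The condition is a finite intersection of local ones, over the support of `m` outside `S`. -/
lemma relIndex_congruenceSubgroup_ne_zero (F : Type*) {K : Type*} [Field F] [Finite F] [Field K]
    [Algebra F⟮X⟯ K] [FunctionField F K] [Algebra F K] [IsScalarTower F F⟮X⟯ K]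
    (S : Set (Place K)) (m : Place K →₀ ℕ) :
    (congruenceSubgroup S m).relIndex (congruenceSubgroup S 0) ≠ 0 := by
  let f : {p : m.support // (p : Place K) ∉ S} → Subgroup (Ideles K) := fun p =>
    (p.1.1.oneUnits (m p.1)).comap (RestrictedProduct.evalMonoidHom _ p.1.1)
  have hf : (⨅ p, f p).relIndex (congruenceSubgroup S 0) ≠ 0 := by
    refine Subgroup.relIndex_iInf_ne_zero fun p => ?_
    rw [Subgroup.relIndex_comap]
    refine fun h => relIndex_oneUnits_ne_zero F p.1.1 (m p.1)
      (Subgroup.relIndex_eq_zero_of_le_right ?_ h)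
    rintro _ ⟨a, ha, rfl⟩
    exact ha _ p.2
  rw [← Subgroup.inf_relIndex_right] at hf
  refine fun h => hf (Subgroup.relIndex_eq_zero_of_le_left ?_ h)
  rintro a ⟨ha, ha'⟩ p hp
  by_cases hpm : p ∈ m.support
  · exact (Subgroup.mem_iInf.1 ha) ⟨⟨p, hpm⟩, hp⟩
  · rw [Finsupp.notMem_support_iff.1 hpm]
    exact ha' p hp

variable (F : Type*) {K : Type*} [Field F] [Finite F] [Field K]
  [Algebra F⟮X⟯ K] [FunctionField F K]

@[simp]
lemma principalIdele_apply (x : Kˣ) (p : Place K) :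
    ((principalIdele F K x p : (p.Completion)ˣ) : p.Completion) = p.toCompletion x := rfl

variable {F} in
lemma principalIdele_mem_congruenceSubgroup_zero {S : Set (Place K)} {x : Kˣ} :
    principalIdele F K x ∈ congruenceSubgroup S 0 ↔ ∀ p ∉ S, p.val x = 1 :=
  forall₂_congr fun p _ => (p.mem_oneUnits_zero _).trans (by
    rw [principalIdele_apply, v_toCompletion])

lemma exists_unit_of_principalIdele_mem {S : Set (Place K)} {x : Kˣ}
    (h : principalIdele F K x ∈ congruenceSubgroup S 0) :
    ∃ u : (ringOfSIntegers S)ˣ, ((u : ringOfSIntegers S) : K) = x := by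
  have hmem (y : Kˣ) (hy : principalIdele F K y ∈ congruenceSubgroup S 0) :
      (y : K) ∈ ringOfSIntegers S := by
    simp only [ringOfSIntegers, Subring.mem_iInf]
    intro p hp
    exact (p.val_le_one_iff _).1 (principalIdele_mem_congruenceSubgroup_zero.1 hy p hp).le
  exact ⟨⟨⟨x, hmem x h⟩, ⟨(x⁻¹ : Kˣ), hmem x⁻¹ (by rw [map_inv]; exact inv_mem h)⟩,
    Subtype.ext (Units.mul_inv x), Subtype.ext (Units.inv_mul x)⟩, rfl⟩

lemma mulExact_rayMap₁_rayMap₂ (S : Set (Place K)) (m : Place K →₀ ℕ) :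
    Function.MulExact (rayMap₁ F S m) (rayMap₂ F S m) := by
  intro c
  obtain ⟨a, rfl⟩ := QuotientGroup.mk_surjective c
  constructor
  · intro h
    have h1 : (a : Ideles K) ∈ (principalIdele F K).range ⊔ congruenceSubgroup S m :=
      (QuotientGroup.eq_one_iff _).1 h
    obtain ⟨_, ⟨x, rfl⟩, b, hb, hab⟩ := Subgroup.mem_sup.1 h1
    -- The principal factor is a quotient of two elements of $\mathcal I_S^{\mathfrak o}$, hence
    -- comes from an $S$-unit.
    have hx : principalIdele F K x ∈ congruenceSubgroup S 0 := by
      rw [eq_mul_inv_of_mul_eq hab]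
      exact mul_mem a.2 (inv_mem (congruenceSubgroup_le S m hb))
    obtain ⟨u, hu⟩ := exists_unit_of_principalIdele_mem F hx
    refine ⟨u, QuotientGroup.eq.2 ?_⟩
    have hux : Units.map ((ringOfSIntegers S).subtype : ringOfSIntegers S →* K) u = x :=
      Units.ext hu
    have h2 : ((unitsToCongruenceSubgroup F S u : congruenceSubgroup S 0) : Ideles K) =
        principalIdele F K x := by
      rw [← hux]; rfl
    rw [Subgroup.mem_subgroupOf, Subgroup.coe_mul, Subgroup.coe_inv, h2, ← hab,
      inv_mul_cancel_left]
    exact hb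
  · rintro ⟨u, hu⟩
    rw [← hu]
    exact (QuotientGroup.eq_one_iff _).2 (Subgroup.mem_sup_left ⟨_, rfl⟩)

lemma mulExact_rayMap₂_rayMap₃ (S : Set (Place K)) (m : Place K →₀ ℕ) :
    Function.MulExact (rayMap₂ F S m) (rayMap₃ F S m) := by
  intro c
  obtain ⟨a, rfl⟩ := QuotientGroup.mk_surjective c
  constructor
  · intro h
    have h1 : a ∈ (principalIdele F K).range ⊔ congruenceSubgroup S 0 :=
      (QuotientGroup.eq_one_iff _).1 h
    obtain ⟨x, hx, b, hb, hab⟩ := Subgroup.mem_sup.1 h1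
    refine ⟨QuotientGroup.mk ⟨b, hb⟩, QuotientGroup.eq.2 ?_⟩
    change b⁻¹ * a ∈ _
    rw [← hab, mul_comm x, inv_mul_cancel_left]
    exact Subgroup.mem_sup_left hx
  · rintro ⟨d, hd⟩
    obtain ⟨b, rfl⟩ := QuotientGroup.mk_surjective d
    rw [← hd]
    exact (QuotientGroup.eq_one_iff _).2 (Subgroup.mem_sup_right b.2)

lemma surjective_rayMap₃ (S : Set (Place K)) (m : Place K →₀ ℕ) :
    Function.Surjective (rayMap₃ F S m) := by
  intro c
  obtain ⟨a, rfl⟩ := QuotientGroup.mk_surjective c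
  exact ⟨QuotientGroup.mk a, rfl⟩

variable [Algebra F K] [IsScalarTower F F⟮X⟯ K]

/-- `log` is minus the additive valuation, so `E - E'` is the divisor of the idèle. -/
lemma exists_divisor_idele (a : Ideles K) : ∃ E E' : Place K →₀ ℕ, ∀ p : Place K,
    log (Valued.v ((a p : (p.Completion)ˣ) : p.Completion)) = (E' p : ℤ) - E p := by
  let l (p : Place K) : ℤ := log (Valued.v ((a p : (p.Completion)ˣ) : p.Completion))
  have hfin : {p | l p ≠ 0}.Finite := by
    refine Set.Finite.subset a.2 fun p hp h => hp ?_
    have h1 : Valued.v ((a p : (p.Completion)ˣ) : p.Completion) = 1 := h.1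
    change log (Valued.v ((a p : (p.Completion)ˣ) : p.Completion)) = 0
    rw [h1, log_one]
  refine ⟨Finsupp.ofSupportFinite (fun p => (-l p).toNat) (hfin.subset fun p hp h => hp ?_),
    Finsupp.ofSupportFinite (fun p => (l p).toNat) (hfin.subset fun p hp h => hp ?_), fun p => ?_⟩
  · simp [h]
  · simp [h]
  · change l p = ((l p).toNat : ℤ) - (-l p).toNat
    omega

/-- The `S`-class group is finite. -/
lemma finiteIndex_range_sup_congruenceSubgroup_zero (hF : algebraicClosure F K = ⊥)
    {S : Set (Place K)} (hS : S.Nonempty) :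
    ((principalIdele F K).range ⊔ congruenceSubgroup S 0).FiniteIndex := by
  obtain ⟨p₀, hp₀⟩ := hS
  obtain ⟨B, hB⟩ := exists_equiv_effective hF p₀
  obtain ⟨x, hx0, hx1⟩ := p₀.exists_val_lt_one
  have hx : Transcendental F x := p₀.transcendental_of_val_ne_one hx0 hx1.ne
  have hfin := finite_divNorm_le F hx B
  have key (a : Ideles K) : ∃ y : Kˣ, ∃ G : {E : Place K →₀ ℕ | divNorm E ≤ B}, ∀ p ≠ p₀,
      Valued.v (((principalIdele F K y * a) p : (p.Completion)ˣ) : p.Completion) =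
        exp (-(G.1 p : ℤ)) := by
    obtain ⟨E, E', hE⟩ := exists_divisor_idele a
    obtain ⟨y, hy0, G, hG, hyG⟩ := hB E E'
    refine ⟨Units.mk0 y hy0, ⟨G, hG⟩, fun p hp => ?_⟩
    rw [RestrictedProduct.mul_apply, Units.val_mul, principalIdele_apply, map_mul, v_toCompletion,
      Units.val_mk0, p.val_eq_exp_logVal hy0, hyG p hp,
      ← exp_log (x := Valued.v ((a p : (p.Completion)ˣ) : p.Completion)) (by simp), hE, ← exp_add]
    congr 1
    change _ = -(G p : ℤ)
    ring
  choose y G hyG using key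
  let H := (principalIdele F K).range ⊔ congruenceSubgroup S 0
  -- Ideles whose normalizations have the same `G` differ by a principal idèle and an idèle that is
  -- a unit outside `p₀`; since `p₀ ∈ S`, nothing is required at `p₀`.
  have hinj : Function.Injective fun c : Ideles K ⧸ H => G c.out := by
    intro c d hcd
    rw [← c.out_eq, ← d.out_eq]
    refine QuotientGroup.eq.2 ?_
    set a := c.out
    set b := d.out
    have hab : a⁻¹ * b = (principalIdele F K (y a * (y b)⁻¹)) *
        ((principalIdele F K (y a) * a)⁻¹ * (principalIdele F K (y b) * b)) := by
      rw [map_mul, map_inv]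
      simp only [mul_inv_rev]
      generalize principalIdele F K (y a) = α
      generalize principalIdele F K (y b) = β
      calc a⁻¹ * b = a⁻¹ * b * (α * α⁻¹) * (β⁻¹ * β) := by simp
        _ = _ := by ac_rfl
    rw [hab]
    refine mul_mem (Subgroup.mem_sup_left ⟨_, rfl⟩) (Subgroup.mem_sup_right fun p hp => ?_)
    have hpp : p ≠ p₀ := by rintro rfl; exact hp hp₀
    refine (p.mem_oneUnits_zero _).2 ?_
    rw [RestrictedProduct.mul_apply, RestrictedProduct.inv_apply, Units.val_mul, Units.val_inv_eq_inv_val,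
      map_mul, map_inv₀, hyG a p hpp, hyG b p hpp]
    have : G a = G b := hcd
    rw [this]
    exact inv_mul_cancel₀ exp_ne_zero
  have : Finite {E : Place K →₀ ℕ | divNorm E ≤ B} := hfin
  have : Finite (Ideles K ⧸ H) := Finite.of_injective _ hinj
  exact Subgroup.finiteIndex_of_finite_quotient

/-- The extra index beyond the $S$-class group is bounded by $(\mathcal I_S^{\mathfrak o}:\mathcal
I_S^{\mathfrak m})$. -/
lemma finiteIndex_range_sup_congruenceSubgroup (hF : algebraicClosure F K = ⊥)
    {S : Set (Place K)} (hS : S.Nonempty) (m : Place K →₀ ℕ) :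
    ((principalIdele F K).range ⊔ congruenceSubgroup S m).FiniteIndex := by
  let R := (principalIdele F K).range
  have h0 : (R ⊔ congruenceSubgroup S 0).index ≠ 0 :=
    (finiteIndex_range_sup_congruenceSubgroup_zero F hF hS).index_ne_zero
  have hle : R ⊔ congruenceSubgroup S m ≤ R ⊔ congruenceSubgroup S 0 :=
    sup_le_sup_left (congruenceSubgroup_le S m) _
  have h1 : (R ⊔ congruenceSubgroup S m).relIndex (R ⊔ congruenceSubgroup S 0) ≠ 0 := by
    have h2 : R ⊔ congruenceSubgroup S 0 =
        congruenceSubgroup S 0 ⊔ (R ⊔ congruenceSubgroup S m) := by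
      rw [sup_left_comm, sup_eq_left.2 (congruenceSubgroup_le S m)]
    rw [h2, Subgroup.relIndex_sup_right]
    exact fun h => relIndex_congruenceSubgroup_ne_zero F S m
      (Subgroup.relIndex_eq_zero_of_le_left le_sup_right h)
  refine ⟨?_⟩
  rw [← Subgroup.relIndex_mul_index hle]
  exact mul_ne_zero h1 h0

lemma finiteIndex_classCongruenceSubgroup (hF : algebraicClosure F K = ⊥)
    {S : Set (Place K)} (hS : S.Nonempty) (m : Place K →₀ ℕ) :
    (classCongruenceSubgroup F S m).FiniteIndex := by
  have h := (finiteIndex_range_sup_congruenceSubgroup F hF hS m).index_ne_zero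
  refine ⟨?_⟩
  rw [← Subgroup.index_comap_of_surjective _
    (QuotientGroup.mk'_surjective (principalIdele F K).range), classCongruenceSubgroup,
    Subgroup.comap_map_eq, QuotientGroup.ker_mk', sup_comm]
  exact h

end Ideles

theorem mainTheorem9 (F K : Type*) [Field F] [Finite F] [Field K]
    [Algebra F⟮X⟯ K] [FunctionField F K] [Algebra F K] [IsScalarTower F F⟮X⟯ K]
    (hF : algebraicClosure F K = ⊥)
    (S : Set (Place K)) (hS : S.Nonempty) (m : Place K →₀ ℕ) (hm : IsCycle S m) :
    (Function.MulExact (rayMap₁ F S m) (rayMap₂ F S m) ∧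
      Function.MulExact (rayMap₂ F S m) (rayMap₃ F S m) ∧
      Function.Surjective (rayMap₃ F S m)) ∧
    (classCongruenceSubgroup F S m).FiniteIndex :=
  ⟨⟨mulExact_rayMap₁_rayMap₂ F S m, mulExact_rayMap₂_rayMap₃ F S m, surjective_rayMap₃ F S m⟩,
    finiteIndex_classCongruenceSubgroup F hF hS m⟩
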